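/- Let $M>0$ and let $f:[0,1)^2\to[0,M]$ be a function of bounded variation (that is, $f\in L_1$ and the first order distributional derivatives of $f$ are finite signed measures) that is not almost everywhere equal to a constant. Then there are constants $\tilde c,C_1,C_2,C_3>0$, independent of $J$, $m$, $\rho$, $\eta$ and of the noise $\varepsilon$ below, with the following property. Let $J\in\mathbb N$, let $\mathbf\Omega=\{0,\dots,2^J-1\}^2$, let $\mathbf f[k]=2^{2J}\int_{Q_k}f(x)\,dx$ for $k\in\mathbf\Omega$ be the average of $f$ over the cell $Q_k=\prod_{j=1}^2[2^{-J}k_j,2^{-J}(k_j+1))$, let $\varepsilon\in\mathbb R^{\mathbf\Omega}$ be fixed and put $\mathbf g=\mathbf f+\varepsilon$. Let $\eta\ge 0$, $1\le m\le 2^{2J}$, $\rho=m/2^{2J}$, and let $\Lambda$ be chosen uniformly at random among all $m$-element subsets of $\mathbf\Omega$. For $\mathbf u\in\mathbb R^{\mathbf\Omega}$ let $$\|\nabla \mathbf u\|_1=\sum_{j=1}^{2}\ \sum_{k,\,k+e_j\in\mathbf\Omega}|\mathbf u[k+e_j]-\mathbf u[k]|$$ and consider the problem, which involves only the values of $\mathbf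 g$ on $\Lambda$, $$\min_{\mathbf u\in\mathbb R^{\mathbf\Omega}}\|\nabla \mathbf u\|_1\quad\text{subject to}\quad \frac1{|\Lambda|}\sum_{k\in\Lambda}|\mathbf u[k]-\mathbf g[k]|^2\le\eta^2. \tag{P}$$ Call $\Lambda$ admissible if $\mathbf g[k]\in[0,M]$ for all $k\in\Lambda$ and $$\frac1{|\Lambda|}\sum_{k\in\Lambda}|\varepsilon[k]|^2\le\eta^2\le\frac1{|\Lambda|}\sum_{k\in\Lambda}\Big|\mathbf g[k]-\frac1{|\Lambda|}\sum_{l\in\Lambda}\mathbf g[l]\Big|^2 .$$ Then, with probability at least $1-2^{-2J}$, the following holds: if $\Lambda$ is admissible, then every solution $\mathbf u^\Lambda$ of (P) satisfies $$\frac1{2^{2J}}\sum_{k\in\mathbf\Omega}\big|\mathbf u^\Lambda[k]-\mathbf f[k]\big|^2\le\tilde c\,\rho^{-1/2}J^{3/2}2^{-J/2}+\frac{16}{3}\eta^2$$ and $$\|u_J^\Lambda-f\|_{L_2([0,1)^2)}^2\le C_1\rho^{-1/2}J^{3/2}2^{-J/2}+C_2\eta^2+C_3 2^{-J},$$ where $$u_J^\Lambda(x)=\sum_{k\in\mathbf\Omega}\mathbf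 u^\Lambda[k]\sum_{l\in\mathbb Z^2}\phi(2^Jx-k+2^Jl),\qquad \phi(x)=\max\{1-|x_1|,0\}\,\max\{1-|x_2|,0\},$$ is the (periodic) piecewise bilinear interpolant of $\mathbf u^\Lambda$. -/

import Mathlib

open MeasureTheory
open scoped ContDiff

noncomputable section

namespace TVInpainting

/-! ### Functions of bounded variation on the unit square -/

/-- The unit square `[0,1)²`. -/
def unitSquare : Set (ℝ × ℝ) := Set.Ico 0 1 ×ˢ Set.Ico 0 1

/-- Its interior, the open unit square `(0,1)²`. -/
def openSquare : Set (ℝ × ℝ) := Set.Ioo 0 1 ×ˢ Set.Ioo 0 1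

/-- Lebesgue measure on the unit square. -/
def squareMeasure : Measure (ℝ × ℝ) := volume.restrict unitSquare

/-- Smooth real-valued test functions with compact support in the open unit square. -/
structure IsTest (ψ : ℝ × ℝ → ℝ) : Prop where
  smooth : ContDiff ℝ ∞ ψ
  compact : HasCompactSupport ψ
  support : tsupport ψ ⊆ openSquare

/-- The integral of a function against a finite signed measure. -/
def signedIntegral (μ : SignedMeasure (ℝ × ℝ)) (ψ : ℝ × ℝ → ℝ) : ℝ :=
  (∫ x, ψ x ∂μ.toJordanDecomposition.posPart) - ∫ x, ψ x ∂μ.toJordanDecomposition.negPart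

/-- On the open square, the distributional derivative of `f` in the direction `e`
is the finite signed measure `μ`. -/
def HasMeasureDerivative (f : ℝ × ℝ → ℝ) (e : ℝ × ℝ) (μ : SignedMeasure (ℝ × ℝ)) : Prop :=
  ∀ ψ : ℝ × ℝ → ℝ, IsTest ψ →
    ∫ x, f x * fderiv ℝ ψ x e ∂squareMeasure = -signedIntegral μ ψ

/-- Functions of bounded variation on the unit square: integrable, and both first order
distributional derivatives are finite signed measures. -/
structure IsBV (f : ℝ × ℝ → ℝ) : Prop where
  integrable : Integrable f squareMeasure
  deriv_fst : ∃ μ : SignedMeasure (ℝ × ℝ), HasMeasureDerivative f (1, 0) μ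
  deriv_snd : ∃ μ : SignedMeasure (ℝ × ℝ), HasMeasureDerivative f (0, 1) μ

/-! ### The grid, sampling and interpolation -/

/-- The index set `{0, …, 2^J - 1}²`. -/
abbrev Grid (J : ℕ) : Type := Fin (2 ^ J) × Fin (2 ^ J)

/-- The cell `∏ⱼ [2^{-J} kⱼ, 2^{-J} (kⱼ + 1))`. -/
def cell (J : ℕ) (k : Grid J) : Set (ℝ × ℝ) :=
  Set.Ico ((k.1 : ℝ) / 2 ^ J) (((k.1 : ℝ) + 1) / 2 ^ J) ×ˢ
    Set.Ico ((k.2 : ℝ) / 2 ^ J) (((k.2 : ℝ) + 1) / 2 ^ J)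

/-- The discrete samples of `f`: its averages over the cells, which have area `2^{-2J}`. -/
def sample (J : ℕ) (f : ℝ × ℝ → ℝ) (k : Grid J) : ℝ :=
  2 ^ (2 * J) * ∫ x in cell J k, f x

/-- The piecewise linear B-spline `B₂`. -/
def hat (x : ℝ) : ℝ := max (1 - |x|) 0

/-- The tensor product B-spline. -/
def tensorHat (x : ℝ × ℝ) : ℝ := hat x.1 * hat x.2

/-- The 1-periodization of `x ↦ φ(2^J x - k)`. At each point only finitely many terms of the
sum over `ℤ²` are nonzero. -/
def periodicHat (J : ℕ) (k : Grid J) (x : ℝ × ℝ) : ℝ :=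
  ∑' l : ℤ × ℤ, tensorHat
    (2 ^ J * x.1 - (k.1 : ℝ) + 2 ^ J * (l.1 : ℝ), 2 ^ J * x.2 - (k.2 : ℝ) + 2 ^ J * (l.2 : ℝ))

/-- The piecewise bilinear interpolant of grid data. -/
def interpolant (J : ℕ) (u : Grid J → ℝ) (x : ℝ × ℝ) : ℝ :=
  ∑ k : Grid J, u k * periodicHat J k x

/-! ### The constrained total variation minimization problem -/

/-- The anisotropic discrete total variation; only differences between two grid points count. -/
def gridTV (J : ℕ) (u : Grid J → ℝ) : ℝ :=
  ∑ k : Grid J,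
    ((if h : (k.1 : ℕ) + 1 < 2 ^ J then |u (⟨(k.1 : ℕ) + 1, h⟩, k.2) - u k| else 0) +
      (if h : (k.2 : ℕ) + 1 < 2 ^ J then |u (k.1, ⟨(k.2 : ℕ) + 1, h⟩) - u k| else 0))

/-- The average of `h` over the finite index set `S`. -/
def average {ι : Type*} (S : Finset ι) (h : ι → ℝ) : ℝ :=
  (1 / (S.card : ℝ)) * ∑ k ∈ S, h k

/-- The constraint of the minimization problem with data `g` on `S` and noise level `η`. -/
def IsFeasible {J : ℕ} (S : Finset (Grid J)) (g : Grid J → ℝ) (η : ℝ) (u : Grid J → ℝ) : Prop :=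
  average S (fun k => |u k - g k| ^ 2) ≤ η ^ 2

/-- `u` minimizes the discrete total variation subject to the constraint. Only the values of
`g` on `S` matter. -/
def IsTVSolution {J : ℕ} (S : Finset (Grid J)) (g : Grid J → ℝ) (η : ℝ) (u : Grid J → ℝ) : Prop :=
  IsFeasible S g η u ∧ ∀ v : Grid J → ℝ, IsFeasible S g η v → gridTV J u ≤ gridTV J v

/-- The standing assumptions on data `g = f + ε` observed on `S`: the values of `g` lie in
`[0,M]`, and `η²` lies between the mean square of `ε` and the variance of `g`, both on `S`. -/
structure IsAdmissible {J : ℕ} (S : Finset (Grid J)) (M η : ℝ) (g ε : Grid J → ℝ) : Prop where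
  range : ∀ k ∈ S, g k ∈ Set.Icc 0 M
  noise_le : average S (fun k => |ε k| ^ 2) ≤ η ^ 2
  le_variance : η ^ 2 ≤ average S (fun k => |g k - average S g| ^ 2)

open Classical in
/-- The probability of the event `E` for a uniformly random `m`-element subset. -/
def subsetProb {ι : Type*} [Fintype ι] (m : ℕ) (E : Finset ι → Prop) : ℝ :=
  (((Finset.univ : Finset ι).powersetCard m).filter E).card /
    (((Finset.univ : Finset ι).powersetCard m).card : ℝ)

end TVInpainting

end

open MeasureTheory
open scoped ContDiff

noncomputable section

namespace TVInpainting

/-! ### Translates of functions of bounded variation -/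

/-! The proof is a uniform law of large numbers over a class of small entropy. Let a be the samples
of f, N = 2^{2J}, V the total mass of the two derivative measures, and R the rate ρ^{-1/2} J^{3/2}
2^{-J/2}, so that R² m = 2^J J³.

A BV function moves in L¹ by at most V|h| under a translation by h along an axis, hence a has grid
variation at most 2^J V (`gridTV_sample_le`). When Λ is admissible, a is feasible, so every solution
u has variation at most 2^J V too; and u takes values in [0,M], since clipping would otherwise
improve it (`IsTVSolution.mem_Icc`).

Round u to multiples of R with a well-chosen offset; the variation in units of R stays below 2^J V /
R (`exists_rounding`). Integer grid functions with that variation and a bounded range number only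
exp(O(J 2^J / R)) up to harmless factors (`exists_finset_integer_variation`). For each of them a
Chernoff bound for sampling without replacement (`card_filter_sum_le`) says that the mean of (Rv -
a)² over Λ is at least 3/4 of the full mean minus O(R), except with probability about exp(-c m R).
Since m R = 2^J J³ / R, the union bound closes (`entropy_le_exp`, `discrete_bound`). On Λ the mean
of (u - a)² is at most 4η² by feasibility, whence 4/3 · 4 = 16/3.

For the L² estimate, the periodized hats form a partition of unity: interpolating u - a costs a
constant factor, and the interpolant of a differs from f in L¹ by O(2^{-J}), by averaging the
translation estimate over a small box (`setLIntegral_sq_hatInterp_sub_le`). -/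

/-- The total mass of a finite signed measure. -/
def totalMass (μ : SignedMeasure (ℝ × ℝ)) : ℝ :=
  μ.toJordanDecomposition.posPart.real Set.univ + μ.toJordanDecomposition.negPart.real Set.univ

lemma totalMass_nonneg (μ : SignedMeasure (ℝ × ℝ)) : 0 ≤ totalMass μ := by
  unfold totalMass; positivity

lemma abs_signedIntegral_le (μ : SignedMeasure (ℝ × ℝ)) {ψ : ℝ × ℝ → ℝ} (h : ∀ x, |ψ x| ≤ 1) :
    |signedIntegral μ ψ| ≤ totalMass μ := by
  have h1 : ∀ ν : Measure (ℝ × ℝ), IsFiniteMeasure ν → |∫ x, ψ x ∂ν| ≤ ν.real Set.univ := by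
    intro ν _
    have := norm_integral_le_of_norm_le_const (μ := ν) (f := ψ) (C := 1)
      (Filter.Eventually.of_forall fun x => by simpa using h x)
    simpa using this
  unfold signedIntegral totalMass
  exact (abs_sub _ _).trans (add_le_add (h1 _ inferInstance) (h1 _ inferInstance))

lemma isOpen_openSquare : IsOpen openSquare := isOpen_Ioo.prod isOpen_Ioo

lemma convex_openSquare : Convex ℝ openSquare := (convex_Ioo 0 1).prod (convex_Ioo 0 1)

lemma measurableSet_unitSquare : MeasurableSet unitSquare := measurableSet_Ico.prod measurableSet_Ico

lemma unitSquare_ae_eq : unitSquare =ᵐ[volume] openSquare := by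
  have := Measure.set_prod_ae_eq (μ := (volume : Measure ℝ)) (ν := (volume : Measure ℝ))
    (Ioo_ae_eq_Ico (a := (0:ℝ)) (b := 1)).symm (Ioo_ae_eq_Ico (a := (0:ℝ)) (b := 1)).symm
  exact this

/-- By convexity of the square, a support that stays inside after the full shift stays inside at
every intermediate time. -/
lemma isTest_translate {ψ : ℝ × ℝ → ℝ} (hψ : ContDiff ℝ ∞ ψ) (hc : HasCompactSupport ψ)
    {e : ℝ × ℝ} {h t : ℝ} (ht : t ∈ segment ℝ 0 h)
    (hsupp : tsupport ψ ⊆ {x | x ∈ openSquare ∧ x + h • e ∈ openSquare}) :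
    IsTest (fun x => ψ (x - t • e)) := by
  refine ⟨hψ.comp (contDiff_id.sub contDiff_const), ?_, ?_⟩
  · exact hc.comp_homeomorph (Homeomorph.subRight (t • e))
  · intro x hx
    have hx' : x - t • e ∈ tsupport ψ :=
      tsupport_comp_subset_preimage ψ (f := fun x => x - t • e) (by fun_prop) hx
    obtain ⟨h1, h2⟩ := hsupp hx'
    obtain ⟨a, b, ha, hb, hab, rfl⟩ := ht
    have := convex_openSquare h1 h2 ha hb hab
    convert this using 1
    rw [smul_add, ← add_assoc, ← add_smul, hab]
    simp [smul_smul]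

lemma integral_squareMeasure {F G : ℝ × ℝ → ℝ} (hs : ∀ x, x ∉ unitSquare → F x = 0) :
    ∫ x, F x * G x ∂squareMeasure = ∫ x, F x * G x :=
  setIntegral_eq_integral_of_forall_compl_eq_zero fun x hx => by simp [hs x hx]

/-- Mean value inequality in t: the derivative of ∫ F(x) ψ(x - te) dx is the integral of the
translated ψ against `μ`, hence at most the total mass for every t between 0 and h. -/
lemma abs_integral_translate_sub_le {F : ℝ × ℝ → ℝ} (hF : Integrable F)
    (hs : ∀ x, x ∉ unitSquare → F x = 0) {e : ℝ × ℝ} {μ : SignedMeasure (ℝ × ℝ)}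
    (hμ : HasMeasureDerivative F e μ) {h : ℝ} {ψ : ℝ × ℝ → ℝ} (hψ : ContDiff ℝ ∞ ψ)
    (hc : HasCompactSupport ψ)
    (hsupp : tsupport ψ ⊆ {x | x ∈ openSquare ∧ x + h • e ∈ openSquare})
    (hb : ∀ x, |ψ x| ≤ 1) :
    |(∫ x, F x * ψ (x - h • e)) - ∫ x, F x * ψ x| ≤ totalMass μ * |h| := by
  have hdiff : Differentiable ℝ ψ := hψ.differentiable (by simp)
  have hcf : Continuous (fderiv ℝ ψ) := hψ.continuous_fderiv (by simp)
  obtain ⟨C, hC⟩ := (hc.fderiv (𝕜 := ℝ)).exists_bound_of_continuous hcf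
  have hd : ∀ (x : ℝ × ℝ) (t : ℝ),
      HasDerivAt (fun t => F x * ψ (x - t • e)) (F x * -(fderiv ℝ ψ (x - t • e) e)) t := by
    intro x t
    have h1 : HasDerivAt (fun t : ℝ => x - t • e) (-e) t := by
      simpa using ((hasDerivAt_id t).smul_const e).const_sub x
    have h2 := (hdiff (x - t • e)).hasFDerivAt.comp_hasDerivAt t h1
    simpa using h2.const_mul (F x)
  have hT : ∀ t : ℝ, HasDerivAt (fun t : ℝ => ∫ x, F x * ψ (x - t • e))
      (∫ x, F x * -(fderiv ℝ ψ (x - t • e) e)) t := by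
    intro t
    refine (hasDerivAt_integral_of_dominated_loc_of_deriv_le (𝕜 := ℝ) (s := Set.univ) (x₀ := t)
      (F := fun (t : ℝ) x => F x * ψ (x - t • e))
      (F' := fun (t : ℝ) x => F x * -(fderiv ℝ ψ (x - t • e) e))
      (bound := fun x => ‖F x‖ * (C * ‖e‖)) Filter.univ_mem ?_ ?_ ?_ ?_ ?_ ?_).2
    · refine Filter.Eventually.of_forall fun t => hF.aestronglyMeasurable.mul ?_
      exact (hdiff.continuous.comp (by fun_prop)).aestronglyMeasurable
    · refine hF.mul_bdd (c := 1) (hdiff.continuous.comp (by fun_prop)).aestronglyMeasurable ?_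
      exact Filter.Eventually.of_forall fun x => by simpa using hb _
    · refine hF.aestronglyMeasurable.mul ?_
      have : Continuous fun x => -(fderiv ℝ ψ (x - t • e)) e := by fun_prop
      exact this.aestronglyMeasurable
    · refine Filter.Eventually.of_forall fun x t _ => ?_
      rw [norm_mul, norm_neg]
      gcongr
      exact (ContinuousLinearMap.le_opNorm _ _).trans (by gcongr; exact hC _)
    · exact hF.norm.mul_const _
    · exact Filter.Eventually.of_forall fun x t _ => hd x t
  have hbound : ∀ t ∈ segment ℝ 0 h,
      ‖∫ x, F x * -(fderiv ℝ ψ (x - t • e) e)‖ ≤ totalMass μ := by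
    intro t ht
    have h1 := hμ _ (isTest_translate hψ hc ht hsupp)
    rw [integral_squareMeasure hs] at h1
    have h2 : ∀ x, fderiv ℝ (fun x => ψ (x - t • e)) x = fderiv ℝ ψ (x - t • e) := by
      intro x; rw [fderiv_comp_sub]
    simp only [h2] at h1
    simp only [mul_neg, integral_neg, h1, neg_neg]
    exact abs_signedIntegral_le μ fun x => hb _
  have := (convex_segment (0 : ℝ) h).norm_image_sub_le_of_norm_hasDerivWithin_le
    (fun t _ => (hT t).hasDerivWithinAt) hbound (left_mem_segment ℝ 0 h) (right_mem_segment ℝ 0 h)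
  simpa using this

/-- Duality: an `L¹` bound from testing against smooth functions. -/
lemma setIntegral_abs_le_of_test {g : ℝ × ℝ → ℝ} (hg : Integrable g) (hgm : Measurable g)
    {U : Set (ℝ × ℝ)} (hU : IsOpen U) (hUb : Bornology.IsBounded U) {C : ℝ}
    (h : ∀ ψ : ℝ × ℝ → ℝ, ContDiff ℝ ∞ ψ → HasCompactSupport ψ → tsupport ψ ⊆ U →
      (∀ x, |ψ x| ≤ 1) → ∫ x, g x * ψ x ≤ C) :
    ∫ x in U, |g x| ≤ C := by
  set ν : Measure (ℝ × ℝ) := volume.withDensity (fun x => ENNReal.ofReal |g x|) with hν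
  have hfin : IsFiniteMeasure ν := isFiniteMeasure_withDensity_ofReal hg.abs.2
  have hreal : ∀ s, MeasurableSet s → ν.real s = ∫ x in s, |g x| := by
    intro s hs
    rw [Measure.real, hν, withDensity_apply _ hs,
      integral_eq_lintegral_of_nonneg_ae (Filter.Eventually.of_forall fun x => abs_nonneg _)
        hg.abs.aestronglyMeasurable.restrict]
  refine le_of_forall_pos_le_add fun δ hδ => ?_
  -- Inner regularity of |g| dx. Two such remainders enter below with weight 2 each, so δ/4 adds up
  -- to δ.
  have key : ∀ s : Set (ℝ × ℝ), MeasurableSet s →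
      ∃ K ⊆ s, IsCompact K ∧ ∫ x in s \ K, |g x| < δ / 4 := by
    intro s hs
    obtain ⟨K, hK, hKc, hlt⟩ := hs.exists_isCompact_sdiff_lt (μ := ν) (measure_ne_top _ _)
      (ε := ENNReal.ofReal (δ / 4)) (by simpa using hδ)
    refine ⟨K, hK, hKc, ?_⟩
    rw [← hreal _ (hs.diff hKc.measurableSet), Measure.real]
    exact (ENNReal.toReal_lt_of_lt_ofReal hlt)
  have hP : MeasurableSet (U ∩ {x | 0 ≤ g x}) :=
    hU.measurableSet.inter (measurableSet_le measurable_const hgm)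
  have hQ : MeasurableSet (U ∩ {x | g x < 0}) :=
    hU.measurableSet.inter (measurableSet_lt hgm measurable_const)
  obtain ⟨K, hKP, hK, hKlt⟩ := key _ hP
  obtain ⟨L, hLQ, hL, hLlt⟩ := key _ hQ
  have hKL : Disjoint K L := by
    rw [Set.disjoint_left]
    intro x hx hx'
    exact absurd (show 0 ≤ g x from (hKP hx).2) (not_le.2 (show g x < 0 from (hLQ hx').2))
  have bump : ∀ K L : Set (ℝ × ℝ), IsCompact K → IsCompact L → K ⊆ U → Disjoint K L →
      ∃ φ : ℝ × ℝ → ℝ, ContDiff ℝ ∞ φ ∧ HasCompactSupport φ ∧ tsupport φ ⊆ U ∧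
        (∀ x, 0 ≤ φ x ∧ φ x ≤ 1) ∧ (∀ x ∈ K, φ x = 1) ∧ ∀ x ∈ L, φ x = 0 := by
    intro K L hK hL hKU hd
    obtain ⟨φ, h0, h1, hr⟩ := exists_contMDiffMap_zero_one_nhds_of_isClosed
      (n := ⊤) (modelWithCornersSelf ℝ (ℝ × ℝ)) (s := Uᶜ ∪ L) (t := K)
      (hU.isClosed_compl.union hL.isClosed) hK.isClosed
      (by
        rw [Set.disjoint_union_left]
        exact ⟨(Set.subset_compl_iff_disjoint_left.1 (by simpa using hKU)), hd.symm⟩)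
    have hts : tsupport φ ⊆ U := by
      intro x hx
      by_contra hxU
      have : ∀ᶠ y in nhds x, φ y = 0 :=
        h0.filter_mono (nhds_le_nhdsSet (Set.mem_union_left L hxU))
      exact (notMem_tsupport_iff_eventuallyEq.2 this) hx
    refine ⟨φ, φ.contMDiff.contDiff, ?_, hts, fun x => ⟨(hr x).1, (hr x).2⟩,
      fun x hx => h1.self_of_nhdsSet x hx,
      fun x hx => h0.self_of_nhdsSet x (Or.inr hx)⟩
    exact (Metric.isCompact_of_isClosed_isBounded (isClosed_tsupport _) (hUb.subset hts))
  obtain ⟨φ, hφ, hφc, hφU, hφr, hφ1, hφ0⟩ := bump K L hK hL (hKP.trans Set.inter_subset_left) hKL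
  obtain ⟨χ, hχ, hχc, hχU, hχr, hχ1, hχ0⟩ :=
    bump L K hL hK (hLQ.trans Set.inter_subset_left) hKL.symm
  have hψb : ∀ x, |φ x - χ x| ≤ 1 := by
    intro x
    rw [abs_le]
    constructor <;> linarith [(hφr x).1, (hφr x).2, (hχr x).1, (hχr x).2]
  have hψU : tsupport (fun x => φ x - χ x) ⊆ U :=
    (tsupport_sub φ χ).trans (Set.union_subset hφU hχU)
  have hψ := h (fun x => φ x - χ x) (hφ.sub hχ) (hφc.sub hχc) hψU hψb
  have hi : Integrable fun x => g x * (φ x - χ x) := by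
    refine hg.mul_bdd (c := 1) (hφ.continuous.sub hχ.continuous).aestronglyMeasurable ?_
    exact Filter.Eventually.of_forall fun x => by simpa using hψb x
  have hz : ∫ x, g x * (φ x - χ x) = ∫ x in U, g x * (φ x - χ x) := by
    refine (setIntegral_eq_integral_of_forall_compl_eq_zero fun x hx => ?_).symm
    have : (fun x => φ x - χ x) x = 0 := by
      by_contra h'
      exact hx (hψU (subset_tsupport _ h'))
    simp only at this
    rw [this, mul_zero]
  have hPK : MeasurableSet ((U ∩ {x | 0 ≤ g x}) \ K) := hP.diff hK.measurableSet
  have hQL : MeasurableSet ((U ∩ {x | g x < 0}) \ L) := hQ.diff hL.measurableSet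
  have hiP : Integrable (((U ∩ {x | 0 ≤ g x}) \ K).indicator fun x => |g x|) := hg.abs.indicator hPK
  have hiQ : Integrable (((U ∩ {x | g x < 0}) \ L).indicator fun x => |g x|) := hg.abs.indicator hQL
  -- φ - χ is a smooth substitute for the sign of g: exact on K and L, while elsewhere in U the loss
  -- is at most 2|g| and is charged to the remainders.
  have hpt : ∀ x ∈ U, |g x| ≤ g x * (φ x - χ x) +
      (2 * ((U ∩ {x | 0 ≤ g x}) \ K).indicator (fun x => |g x|) x +
        2 * ((U ∩ {x | g x < 0}) \ L).indicator (fun x => |g x|) x) := by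
    intro x hx
    have hrest : |g x| ≤ g x * (φ x - χ x) + 2 * |g x| := by
      have : |g x * (φ x - χ x)| ≤ |g x| := by
        rw [abs_mul]; exact mul_le_of_le_one_right (abs_nonneg _) (hψb x)
      linarith [(abs_le.1 this).1]
    have i1 : 0 ≤ ((U ∩ {x | 0 ≤ g x}) \ K).indicator (fun x => |g x|) x :=
      Set.indicator_nonneg (fun _ _ => abs_nonneg _) _
    have i2 : 0 ≤ ((U ∩ {x | g x < 0}) \ L).indicator (fun x => |g x|) x :=
      Set.indicator_nonneg (fun _ _ => abs_nonneg _) _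
    by_cases hxK : x ∈ K
    · have h0 : 0 ≤ g x := (hKP hxK).2
      rw [hφ1 x hxK, hχ0 x hxK, abs_of_nonneg h0]
      linarith
    by_cases hxL : x ∈ L
    · have h0 : g x < 0 := (hLQ hxL).2
      rw [hχ1 x hxL, hφ0 x hxL, abs_of_neg h0]
      linarith
    rcases le_or_gt 0 (g x) with h0 | h0
    · rw [Set.indicator_of_mem (s := (U ∩ {x | 0 ≤ g x}) \ K) ⟨⟨hx, h0⟩, hxK⟩]
      linarith
    · rw [Set.indicator_of_mem (s := (U ∩ {x | g x < 0}) \ L) ⟨⟨hx, h0⟩, hxL⟩]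
      linarith
  calc ∫ x in U, |g x| ≤ ∫ x in U, (g x * (φ x - χ x) +
      (2 * ((U ∩ {x | 0 ≤ g x}) \ K).indicator (fun x => |g x|) x +
        2 * ((U ∩ {x | g x < 0}) \ L).indicator (fun x => |g x|) x)) :=
        setIntegral_mono_on hg.abs.integrableOn
          (hi.add ((hiP.const_mul 2).add (hiQ.const_mul 2))).integrableOn hU.measurableSet hpt
    _ ≤ C + δ := by
        have hi' : Integrable fun x => 2 * ((U ∩ {x | 0 ≤ g x}) \ K).indicator (fun x => |g x|) x +
            2 * ((U ∩ {x | g x < 0}) \ L).indicator (fun x => |g x|) x :=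
          (hiP.const_mul 2).add (hiQ.const_mul 2)
        rw [integral_add hi.integrableOn hi'.integrableOn,
          integral_add (hiP.const_mul 2).integrableOn (hiQ.const_mul 2).integrableOn,
          integral_const_mul, integral_const_mul, setIntegral_indicator hPK,
          setIntegral_indicator hQL, ← hz,
          Set.inter_eq_right.2 (Set.sdiff_subset.trans Set.inter_subset_left),
          Set.inter_eq_right.2 (Set.sdiff_subset.trans Set.inter_subset_left)]
        linarith

/-- The `L¹` modulus of continuity of a function of bounded variation. -/
lemma setIntegral_abs_translate_sub_le {F : ℝ × ℝ → ℝ} (hF : Integrable F) (hm : Measurable F)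
    (hs : ∀ x, x ∉ unitSquare → F x = 0) {e : ℝ × ℝ} {μ : SignedMeasure (ℝ × ℝ)}
    (hμ : HasMeasureDerivative F e μ) (h : ℝ) :
    ∫ x in {x | x ∈ openSquare ∧ x + h • e ∈ openSquare}, |F (x + h • e) - F x| ≤
      totalMass μ * |h| := by
  have hFt : Integrable fun x => F (x + h • e) := hF.comp_add_right (h • e)
  refine setIntegral_abs_le_of_test (hFt.sub hF)
    ((hm.comp (measurable_id.add_const _)).sub hm) ?_ ?_ ?_
  · exact isOpen_openSquare.inter (isOpen_openSquare.preimage (by fun_prop))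
  · exact ((Metric.isBounded_Ioo 0 1).prod (Metric.isBounded_Ioo 0 1)).subset fun x hx => hx.1
  · intro ψ hψ hc hsupp hb
    refine le_trans (le_of_eq ?_)
      ((le_abs_self _).trans (abs_integral_translate_sub_le hF hs hμ hψ hc hsupp hb))
    have h1 : ∫ x, F x * ψ (x - h • e) = ∫ x, F (x + h • e) * ψ x := by
      rw [← integral_add_right_eq_self (fun x => F x * ψ (x - h • e)) (h • e)]
      simp
    have hbd : ∀ᵐ x ∂(volume : Measure (ℝ × ℝ)), ‖ψ x‖ ≤ 1 :=
      Filter.Eventually.of_forall fun x => by simpa using hb x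
    rw [h1, ← integral_sub (hFt.mul_bdd hψ.continuous.aestronglyMeasurable hbd)
      (hF.mul_bdd hψ.continuous.aestronglyMeasurable hbd)]
    simp [sub_mul]

lemma overlap_ae_eq (z : ℝ × ℝ) :
    ({x | x ∈ unitSquare ∧ x + z ∈ unitSquare} : Set (ℝ × ℝ)) =ᵐ[volume]
      {x | x ∈ openSquare ∧ x + z ∈ openSquare} :=
  unitSquare_ae_eq.inter
    ((measurePreserving_add_right volume z).quasiMeasurePreserving.preimage_ae_eq unitSquare_ae_eq)

lemma measurableSet_overlap (z : ℝ × ℝ) :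
    MeasurableSet ({x | x ∈ unitSquare ∧ x + z ∈ unitSquare} : Set (ℝ × ℝ)) :=
  measurableSet_unitSquare.inter (measurableSet_unitSquare.preimage (measurable_add_const z))

lemma measurableSet_openOverlap (z : ℝ × ℝ) :
    MeasurableSet ({x | x ∈ openSquare ∧ x + z ∈ openSquare} : Set (ℝ × ℝ)) :=
  isOpen_openSquare.measurableSet.inter
    (isOpen_openSquare.measurableSet.preimage (measurable_add_const z))

lemma setIntegral_abs_translate_sub_le' {F : ℝ × ℝ → ℝ} (hF : Integrable F) (hm : Measurable F)
    (hs : ∀ x, x ∉ unitSquare → F x = 0) {e : ℝ × ℝ} {μ : SignedMeasure (ℝ × ℝ)}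
    (hμ : HasMeasureDerivative F e μ) (h : ℝ) :
    ∫ x in {x | x ∈ unitSquare ∧ x + h • e ∈ unitSquare}, |F (x + h • e) - F x| ≤
      totalMass μ * |h| := by
  rw [setIntegral_congr_set (overlap_ae_eq (h • e))]
  exact setIntegral_abs_translate_sub_le hF hm hs hμ h

lemma setLIntegral_translate_sub_le {F : ℝ × ℝ → ℝ} (hF : Integrable F) (hm : Measurable F)
    (hs : ∀ x, x ∉ unitSquare → F x = 0) {e : ℝ × ℝ} {μ : SignedMeasure (ℝ × ℝ)}
    (hμ : HasMeasureDerivative F e μ) (h : ℝ) :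
    ∫⁻ x in {x | x ∈ openSquare ∧ x + h • e ∈ openSquare}, ‖F (x + h • e) - F x‖ₑ ≤
      ENNReal.ofReal (totalMass μ * |h|) := by
  have hi : Integrable fun x => F (x + h • e) - F x := (hF.comp_add_right (h • e)).sub hF
  rw [← ofReal_integral_norm_eq_lintegral_enorm hi.integrableOn]
  exact ENNReal.ofReal_le_ofReal (setIntegral_abs_translate_sub_le hF hm hs hμ h)

/-- Go from x to x + z around the corner x + a, horizontally and then vertically. The corner takes
one coordinate from each end, so it lies in the square whenever both ends do. -/
lemma setLIntegral_overlap_le {F : ℝ × ℝ → ℝ} (hF : Integrable F) (hm : Measurable F)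
    (hs : ∀ x, x ∉ unitSquare → F x = 0) {μ ν : SignedMeasure (ℝ × ℝ)}
    (hμ : HasMeasureDerivative F (1, 0) μ) (hν : HasMeasureDerivative F (0, 1) ν) (z : ℝ × ℝ) :
    ∫⁻ x in {x | x ∈ unitSquare ∧ x + z ∈ unitSquare}, ‖F (x + z) - F x‖ₑ ≤
      ENNReal.ofReal (totalMass μ * |z.1| + totalMass ν * |z.2|) := by
  rw [setLIntegral_congr (overlap_ae_eq z), ENNReal.ofReal_add
    (mul_nonneg (totalMass_nonneg _) (abs_nonneg _))
    (mul_nonneg (totalMass_nonneg _) (abs_nonneg _))]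
  set a : ℝ × ℝ := z.1 • (1, 0) with ha
  set b : ℝ × ℝ := z.2 • (0, 1) with hb
  have hz : z = a + b := by ext <;> simp [ha, hb]
  set A : Set (ℝ × ℝ) := {x | x ∈ openSquare ∧ x + a ∈ openSquare}
  set B : Set (ℝ × ℝ) := {x | x ∈ openSquare ∧ x + b ∈ openSquare}
  set G : ℝ × ℝ → ENNReal := fun x => ‖F (x + b) - F x‖ₑ
  set H : ℝ × ℝ → ENNReal := fun x => ‖F (x + a) - F x‖ₑ
  have hsub : ∀ x, x ∈ openSquare → x + z ∈ openSquare → x + a ∈ openSquare := by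
    rintro ⟨x, y⟩ ⟨h1, h2⟩ ⟨h3, h4⟩
    refine ⟨?_, ?_⟩
    · simpa [ha] using h3
    · simpa [ha] using h2
  have hA : MeasurableSet A := measurableSet_openOverlap a
  have hB : MeasurableSet B := measurableSet_openOverlap b
  have hO := measurableSet_openOverlap z
  have hH : Measurable H := ((hm.comp (measurable_id.add_const a)).sub hm).enorm
  rw [← lintegral_indicator hO]
  calc ∫⁻ x, Set.indicator {x | x ∈ openSquare ∧ x + z ∈ openSquare}
        (fun x => ‖F (x + z) - F x‖ₑ) x ≤ ∫⁻ x, (A.indicator H x + B.indicator G (x + a)) := by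
        refine lintegral_mono fun x => ?_
        refine Set.indicator_le (s := {x | x ∈ openSquare ∧ x + z ∈ openSquare})
          (g := fun x => A.indicator H x + B.indicator G (x + a)) ?_ x
        rintro y ⟨h1, h2⟩
        have h3 := hsub y h1 h2
        have h4 : y + a + b = y + z := by rw [hz, add_assoc]
        rw [Set.indicator_of_mem (show y ∈ A from ⟨h1, h3⟩),
          Set.indicator_of_mem (show y + a ∈ B from ⟨h3, by rw [h4]; exact h2⟩)]
        simp only [G, H, h4]
        refine le_trans (le_of_eq ?_) (enorm_add_le _ _)
        congr 1; ring
    _ = (∫⁻ x, A.indicator H x) + ∫⁻ x, B.indicator G (x + a) :=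
        lintegral_add_left (hH.indicator hA) _
    _ = (∫⁻ x in A, H x) + ∫⁻ x in B, G x := by
        rw [lintegral_add_right_eq_self (B.indicator G) a, lintegral_indicator hA,
          lintegral_indicator hB]
    _ ≤ _ := add_le_add (setLIntegral_translate_sub_le hF hm hs hμ z.1)
        (setLIntegral_translate_sub_le hF hm hs hν z.2)

/-! ### The grid -/

lemma mem_cell {J : ℕ} {k : Grid J} {x : ℝ × ℝ} :
    x ∈ cell J k ↔ ((k.1 : ℝ) ≤ 2 ^ J * x.1 ∧ 2 ^ J * x.1 < (k.1 : ℝ) + 1) ∧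
      ((k.2 : ℝ) ≤ 2 ^ J * x.2 ∧ 2 ^ J * x.2 < (k.2 : ℝ) + 1) := by
  have h : (0 : ℝ) < 2 ^ J := by positivity
  simp only [cell, Set.mem_prod, Set.mem_Ico, div_le_iff₀' h, lt_div_iff₀' h]

lemma measurableSet_cell (J : ℕ) (k : Grid J) : MeasurableSet (cell J k) :=
  measurableSet_Ico.prod measurableSet_Ico

lemma cell_subset (J : ℕ) (k : Grid J) : cell J k ⊆ unitSquare := by
  intro x hx
  rw [mem_cell] at hx
  obtain ⟨⟨h1, h2⟩, h3, h4⟩ := hx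
  have h : (0 : ℝ) < 2 ^ J := by positivity
  have k1 : (k.1 : ℝ) + 1 ≤ 2 ^ J := by exact_mod_cast k.1.2
  have k2 : (k.2 : ℝ) + 1 ≤ 2 ^ J := by exact_mod_cast k.2.2
  have p1 : (0 : ℝ) ≤ k.1 := by positivity
  have p2 : (0 : ℝ) ≤ k.2 := by positivity
  refine ⟨⟨?_, ?_⟩, ?_, ?_⟩ <;> by_contra! hc <;> nlinarith

lemma eq_of_mem_cell {J : ℕ} {k l : Grid J} {x : ℝ × ℝ} (hk : x ∈ cell J k) (hl : x ∈ cell J l) :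
    k = l := by
  rw [mem_cell] at hk hl
  obtain ⟨⟨h1, h2⟩, h3, h4⟩ := hk
  obtain ⟨⟨g1, g2⟩, g3, g4⟩ := hl
  have e : ∀ (a b : ℕ) (t : ℝ), (a : ℝ) ≤ t → t < b + 1 → a ≤ b := by
    intro a b t h h'
    have : (a : ℝ) < b + 1 := h.trans_lt h'
    exact Nat.lt_succ_iff.1 (by exact_mod_cast this)
  ext
  · exact le_antisymm (e _ _ _ h1 g2) (e _ _ _ g1 h2)
  · exact le_antisymm (e _ _ _ h3 g4) (e _ _ _ g3 h4)

lemma volume_cell (J : ℕ) (k : Grid J) : volume (cell J k) = ENNReal.ofReal ((2 ^ (2 * J))⁻¹) := by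
  rw [cell, Measure.volume_eq_prod, Measure.prod_prod, Real.volume_Ico, Real.volume_Ico,
    ← ENNReal.ofReal_mul (by rw [← sub_div]; simp)]
  congr 1
  rw [← sub_div, ← sub_div, pow_mul']
  field_simp
  ring

lemma volume_real_cell (J : ℕ) (k : Grid J) : volume.real (cell J k) = (2 ^ (2 * J))⁻¹ := by
  rw [Measure.real, volume_cell, ENNReal.toReal_ofReal (by positivity)]

lemma sum_setIntegral_cell_le {J : ℕ} {G : ℝ × ℝ → ℝ} (hG : Integrable G) (h0 : ∀ x, 0 ≤ G x)
    (s : Finset (Grid J)) {A : Set (ℝ × ℝ)} (hs : ∀ k ∈ s, cell J k ⊆ A) :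
    ∑ k ∈ s, ∫ x in cell J k, G x ≤ ∫ x in A, G x := by
  rw [← integral_biUnion_finset s (fun k _ => measurableSet_cell J k)
    (fun k _ l _ hkl => Set.disjoint_left.2 fun x hx hx' => hkl (eq_of_mem_cell hx hx'))
    (fun k _ => hG.integrableOn)]
  exact setIntegral_mono_set hG.integrableOn (Filter.Eventually.of_forall h0)
    (Filter.Eventually.of_forall (Set.iUnion₂_subset hs))

lemma abs_sample_sub_le {J : ℕ} {F : ℝ × ℝ → ℝ} (hF : Integrable F) {k l : Grid J} {z : ℝ × ℝ}
    (h : ∀ x, x + z ∈ cell J l ↔ x ∈ cell J k) :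
    |sample J F l - sample J F k| ≤ 2 ^ (2 * J) * ∫ x in cell J k, |F (x + z) - F x| := by
  have h1 : ∫ x in cell J l, F x = ∫ x in cell J k, F (x + z) := by
    rw [← integral_indicator (measurableSet_cell J l), ← integral_indicator (measurableSet_cell J k),
      ← integral_add_right_eq_self _ z]
    congr 1
    ext x
    by_cases hx : x ∈ cell J k
    · rw [Set.indicator_of_mem hx, Set.indicator_of_mem ((h x).2 hx)]
    · rw [Set.indicator_of_notMem hx, Set.indicator_of_notMem (mt (h x).1 hx)]
  unfold sample
  rw [← mul_sub, abs_mul, abs_of_nonneg (by positivity), h1,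
    ← integral_sub (hF.comp_add_right z).integrableOn hF.integrableOn]
  gcongr
  exact abs_integral_le_integral_abs

/-- A difference of neighbouring samples is a cell average of F(x + z) - F(x) with |z| = 2^{-J}.
Summed over disjoint cells this is 2^{2J} times the L¹ modulus at 2^{-J}. -/
lemma gridTV_sample_le {F : ℝ × ℝ → ℝ} (hF : Integrable F) (hm : Measurable F)
    (hs : ∀ x, x ∉ unitSquare → F x = 0) {μ ν : SignedMeasure (ℝ × ℝ)}
    (hμ : HasMeasureDerivative F (1, 0) μ) (hν : HasMeasureDerivative F (0, 1) ν) (J : ℕ) :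
    gridTV J (sample J F) ≤ 2 ^ J * (totalMass μ + totalMass ν) := by
  have hpos : (0 : ℝ) < 2 ^ J := by positivity
  -- Both directions at once: `p` says that the neighbour in direction `e` belongs to the grid, `σ`
  -- is that neighbour.
  have main : ∀ (e : ℝ × ℝ) (κ : SignedMeasure (ℝ × ℝ)), HasMeasureDerivative F e κ →
      ∀ (p : Grid J → Prop) [DecidablePred p] (σ : ∀ k, p k → Grid J),
      (∀ k (hk : p k) x, x + ((2 : ℝ) ^ J)⁻¹ • e ∈ cell J (σ k hk) ↔ x ∈ cell J k) →
      ∑ k, (if h : p k then |sample J F (σ k h) - sample J F k| else 0) ≤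
        2 ^ J * totalMass κ := by
    intro e κ hκ p _ σ hσ
    set z : ℝ × ℝ := ((2 : ℝ) ^ J)⁻¹ • e with hz
    have hi : Integrable fun x => |F (x + z) - F x| := ((hF.comp_add_right z).sub hF).abs
    calc ∑ k, (if h : p k then |sample J F (σ k h) - sample J F k| else 0)
        ≤ ∑ k, if p k then 2 ^ (2 * J) * ∫ x in cell J k, |F (x + z) - F x| else 0 := by
          refine Finset.sum_le_sum fun k _ => ?_
          by_cases hk : p k
          · rw [dif_pos hk, if_pos hk]
            exact abs_sample_sub_le hF (hσ k hk)
          · rw [dif_neg hk, if_neg hk]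
      _ = 2 ^ (2 * J) * ∑ k ∈ Finset.univ.filter p, ∫ x in cell J k, |F (x + z) - F x| := by
          rw [Finset.mul_sum, Finset.sum_filter]
      _ ≤ 2 ^ (2 * J) * ∫ x in {x | x ∈ unitSquare ∧ x + z ∈ unitSquare}, |F (x + z) - F x| := by
          gcongr
          refine sum_setIntegral_cell_le hi (fun x => abs_nonneg _) _ fun k hk x hx => ?_
          have hk' : p k := (Finset.mem_filter.1 hk).2
          exact ⟨cell_subset J k hx, cell_subset J _ ((hσ k hk' x).2 hx)⟩
      _ ≤ 2 ^ (2 * J) * (totalMass κ * |((2 : ℝ) ^ J)⁻¹|) := by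
          gcongr
          exact setIntegral_abs_translate_sub_le' hF hm hs hκ _
      _ = 2 ^ J * totalMass κ := by
          rw [abs_of_pos (by positivity), pow_mul']
          field_simp
  unfold gridTV
  rw [Finset.sum_add_distrib, mul_add]
  refine add_le_add
    (main (1, 0) μ hμ (fun k => (k.1 : ℕ) + 1 < 2 ^ J) (fun k h => (⟨(k.1 : ℕ) + 1, h⟩, k.2)) ?_)
    (main (0, 1) ν hν (fun k => (k.2 : ℕ) + 1 < 2 ^ J) (fun k h => (k.1, ⟨(k.2 : ℕ) + 1, h⟩)) ?_)
  · intro k hk x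
    simp [mem_cell, mul_add]
  · intro k hk x
    simp [mem_cell, mul_add]

lemma sample_mem_Icc {F : ℝ × ℝ → ℝ} (hF : Integrable F) {M : ℝ} (h : ∀ x, F x ∈ Set.Icc 0 M)
    (J : ℕ) (k : Grid J) : sample J F k ∈ Set.Icc 0 M := by
  have hpos : (0 : ℝ) < 2 ^ (2 * J) := by positivity
  have hle : ∫ x in cell J k, F x ≤ ∫ x in cell J k, M :=
    setIntegral_mono_on hF.integrableOn (integrableOn_const (by rw [volume_cell]; simp))
      (measurableSet_cell J k) fun x _ => (h x).2
  rw [setIntegral_const, volume_real_cell, smul_eq_mul] at hle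
  refine ⟨mul_nonneg hpos.le (integral_nonneg fun x => (h x).1), ?_⟩
  unfold sample
  calc 2 ^ (2 * J) * ∫ x in cell J k, F x ≤ 2 ^ (2 * J) * ((2 ^ (2 * J))⁻¹ * M) := by gcongr
    _ = M := by field_simp

/-! ### Grid edges -/

/-- The end point of the edge starting at `e.1`, horizontal or vertical according to `e.2`; it is
`e.1` itself if that edge leaves the grid. -/
def tip {J : ℕ} (e : Grid J × Bool) : Grid J :=
  if e.2 then (if h : (e.1.1 : ℕ) + 1 < 2 ^ J then (⟨(e.1.1 : ℕ) + 1, h⟩, e.1.2) else e.1)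
  else (if h : (e.1.2 : ℕ) + 1 < 2 ^ J then (e.1.1, ⟨(e.1.2 : ℕ) + 1, h⟩) else e.1)

/-- Edges that leave the grid are loops under `tip` and contribute zero, so no boundary case
remains. -/
lemma gridTV_eq {J : ℕ} (u : Grid J → ℝ) :
    gridTV J u = ∑ e : Grid J × Bool, |u (tip e) - u e.1| := by
  rw [gridTV, Fintype.sum_prod_type (f := fun e : Grid J × Bool => |u (tip e) - u e.1|)]
  refine Finset.sum_congr rfl fun k _ => ?_
  rw [Fintype.sum_bool]
  congr 1
  · by_cases h : (k.1 : ℕ) + 1 < 2 ^ J <;> simp [tip, h]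
  · by_cases h : (k.2 : ℕ) + 1 < 2 ^ J <;> simp [tip, h]

/-- The grid is connected. -/
lemma eq_of_tip_eq {J : ℕ} {α : Type*} (v : Grid J → α) (h : ∀ e, v (tip e) = v e.1)
    (k l : Grid J) : v k = v l := by
  have h1 : ∀ (i : ℕ) (hi : i < 2 ^ J) (b : Fin (2 ^ J)),
      v (⟨i, hi⟩, b) = v (⟨0, by positivity⟩, b) := by
    intro i
    induction i with
    | zero => intro _ _; rfl
    | succ i ih =>
      intro hi b
      rw [← ih (by omega) b, ← h ((⟨i, by omega⟩, b), true)]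
      simp [tip, hi]
  have h2 : ∀ (i : ℕ) (hi : i < 2 ^ J) (a : Fin (2 ^ J)),
      v (a, ⟨i, hi⟩) = v (a, ⟨0, by positivity⟩) := by
    intro i
    induction i with
    | zero => intro _ _; rfl
    | succ i ih =>
      intro hi a
      rw [← ih (by omega) a, ← h ((a, ⟨i, by omega⟩), false)]
      simp [tip, hi]
  have h3 : ∀ k : Grid J, v k = v (⟨0, by positivity⟩, ⟨0, by positivity⟩) := by
    rintro ⟨a, b⟩
    rw [h1 a.1 a.2 b, h2 b.1 b.2]
  rw [h3 k, h3 l]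

/-! ### Solutions take values in the range of the data -/

lemma abs_clip_sub_le (M a b : ℝ) : |max 0 (min M a) - max 0 (min M b)| ≤ |a - b| := by
  rw [max_comm 0, max_comm 0]
  refine (abs_max_sub_max_le_abs _ _ _).trans ((abs_min_sub_min_le_max M a M b).trans ?_)
  simp

/-- Clipping shortens every edge difference weakly, so equal totals force equality on each edge. At
an edge with an end outside [0,M] this is possible only if both ends agree, and connectedness
spreads the value over the grid. -/
lemma eq_const_of_gridTV_clip_eq {J : ℕ} {M : ℝ} (hM : 0 ≤ M) {u : Grid J → ℝ}
    (h : gridTV J u ≤ gridTV J fun k => max 0 (min M (u k))) {k : Grid J}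
    (hk : u k ∉ Set.Icc 0 M) (l : Grid J) : u l = u k := by
  rw [gridTV_eq, gridTV_eq] at h
  have heq := (Finset.sum_eq_sum_iff_of_le (fun e _ => abs_clip_sub_le M _ _)).1
    (le_antisymm (Finset.sum_le_sum fun e _ => abs_clip_sub_le M _ _) h)
  have prop : ∀ a b : ℝ, |max 0 (min M a) - max 0 (min M b)| = |a - b| → a ∉ Set.Icc 0 M →
      a = b := by
    intro a b hab ha
    rw [Set.mem_Icc, not_and_or, not_le, not_le] at ha
    rcases ha with ha | ha
    · rw [min_eq_right (by linarith), max_eq_left ha.le] at hab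
      by_contra hne
      rcases le_or_gt b 0 with hb | hb
      · rw [min_eq_right (by linarith), max_eq_left hb, sub_self, abs_zero] at hab
        exact hne (sub_eq_zero.1 (abs_eq_zero.1 hab.symm))
      · rw [max_eq_right (le_min hM hb.le), zero_sub, abs_neg, abs_of_nonneg (le_min hM hb.le),
          abs_of_neg (by linarith)] at hab
        linarith [min_le_right M b]
    · rw [min_eq_left ha.le, max_eq_right hM] at hab
      by_contra hne
      rcases le_or_gt M b with hb | hb
      · rw [min_eq_left hb, max_eq_right hM, sub_self, abs_zero] at hab
        exact hne (sub_eq_zero.1 (abs_eq_zero.1 hab.symm))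
      · rw [min_eq_right hb.le, abs_of_pos (a := a - b) (by linarith), abs_of_nonneg
          (by simp [hM, hb.le])] at hab
        linarith [le_max_right 0 b]
  have := eq_of_tip_eq (fun l => u l = u k) (fun e => by
    have he := heq e (Finset.mem_univ e)
    refine propext ⟨fun h1 => ?_, fun h1 => ?_⟩
    · rw [← prop _ _ he (by rw [h1]; exact hk), h1]
    · rw [abs_sub_comm, abs_sub_comm (u (tip e))] at he
      rw [← prop _ _ he (by rw [h1]; exact hk), h1]) k l
  exact (this ▸ rfl : u l = u k)

lemma average_mem_Icc {ι : Type*} {S : Finset ι} (hS : S.Nonempty) {g : ι → ℝ} {M : ℝ}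
    (hg : ∀ k ∈ S, g k ∈ Set.Icc 0 M) : average S g ∈ Set.Icc 0 M := by
  have hc : (0 : ℝ) < S.card := by exact_mod_cast hS.card_pos
  unfold average
  refine ⟨mul_nonneg (by positivity) (Finset.sum_nonneg fun k hk => (hg k hk).1), ?_⟩
  rw [one_div, inv_mul_le_iff₀ hc, ← nsmul_eq_mul]
  exact Finset.sum_le_card_nsmul _ _ _ fun k hk => (hg k hk).2

lemma average_sq_sub_const {ι : Type*} {S : Finset ι} (hS : S.Nonempty) (g : ι → ℝ) (a : ℝ) :
    average S (fun k => |a - g k| ^ 2) =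
      average S (fun k => |g k - average S g| ^ 2) + (a - average S g) ^ 2 := by
  have hc : (S.card : ℝ) ≠ 0 := by exact_mod_cast hS.card_pos.ne'
  have hs : ∑ k ∈ S, g k = S.card * average S g := by
    unfold average; field_simp
  have h1 : ∀ b : ℝ, ∑ k ∈ S, |b - g k| ^ 2 =
      S.card * b ^ 2 - 2 * b * (S.card * average S g) + ∑ k ∈ S, g k ^ 2 := by
    intro b
    rw [← hs, Finset.mul_sum, ← nsmul_eq_mul, ← Finset.sum_const, ← Finset.sum_sub_distrib,
      ← Finset.sum_add_distrib]
    refine Finset.sum_congr rfl fun k _ => ?_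
    rw [sq_abs]; ring
  generalize average S g = y at *
  simp only [abs_sub_comm _ y]
  unfold average
  rw [h1, h1]
  field_simp
  ring

/-- The clipped solution is feasible because the data lie in [0,M]; a solution leaving [0,M] is
therefore constant. As η² is at most the variance of the data, a feasible constant must be their
mean, which lies in [0,M]. -/
lemma IsTVSolution.mem_Icc {J : ℕ} {S : Finset (Grid J)} (hS : S.Nonempty) {M η : ℝ} (hM : 0 ≤ M)
    {g ε u : Grid J → ℝ} (hadm : IsAdmissible S M η g ε) (hu : IsTVSolution S g η u) (k : Grid J) :
    u k ∈ Set.Icc 0 M := by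
  by_contra hk
  have hfeas : IsFeasible S g η fun k => max 0 (min M (u k)) := by
    refine le_trans ?_ hu.1
    unfold average
    refine mul_le_mul_of_nonneg_left (Finset.sum_le_sum fun l hl => ?_) (by positivity)
    refine pow_le_pow_left₀ (abs_nonneg _) ?_ 2
    have hg := hadm.range l hl
    have := abs_clip_sub_le M (u l) (g l)
    rwa [min_eq_right hg.2, max_eq_right hg.1] at this
  have hconst := eq_const_of_gridTV_clip_eq hM (hu.2 _ hfeas) hk
  have h1 : average S (fun l => |u k - g l| ^ 2) ≤ η ^ 2 := by
    have := hu.1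
    unfold IsFeasible at this
    simpa only [hconst] using this
  rw [average_sq_sub_const hS] at h1
  have h2 : u k - average S g = 0 := by
    have := hadm.le_variance
    exact pow_eq_zero_iff two_ne_zero |>.1 (le_antisymm (by linarith) (sq_nonneg _))
  rw [sub_eq_zero] at h2
  exact hk (h2 ▸ average_mem_Icc hS hadm.range)

/-! ### Counting integer-valued functions of small variation -/

/-- Such a d is reached from 0 in K moves, each of them a signed unit vector or no move at all: 2|E|
+ 1 choices per move. -/
lemma exists_finset_l1_ball (E : Type*) [Fintype E] [DecidableEq E] (K : ℕ) :
    ∃ T : Finset (E → ℤ), T.card ≤ (2 * Fintype.card E + 1) ^ K ∧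
      ∀ d : E → ℤ, ∑ e, |d e| ≤ K → d ∈ T := by
  induction K with
  | zero =>
    refine ⟨{0}, by simp, fun d hd => ?_⟩
    have : ∀ e, d e = 0 := by
      intro e
      have := Finset.single_le_sum (f := fun e => |d e|) (fun e _ => abs_nonneg _)
        (Finset.mem_univ e)
      simpa using this.trans hd
    simpa using (funext this : d = 0)
  | succ K ih =>
    obtain ⟨T, hT, hmem⟩ := ih
    let s : Option (E × Bool) → E → ℤ := fun o =>
      match o with
      | none => 0
      | some (e, true) => Pi.single e 1
      | some (e, false) => Pi.single e (-1)
    refine ⟨Finset.image₂ (fun o d => s o + d) Finset.univ T, ?_, fun d hd => ?_⟩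
    · refine (Finset.card_image₂_le _ _ _).trans ?_
      rw [pow_succ, mul_comm, Finset.card_univ, Fintype.card_option, Fintype.card_prod,
        Fintype.card_bool, mul_comm _ 2]
      gcongr
    · by_cases h0 : d = 0
      · exact Finset.mem_image₂.2 ⟨none, Finset.mem_univ _, 0, hmem 0 (by simp), by simp [s, h0]⟩
      obtain ⟨e, he⟩ := Function.ne_iff.1 h0
      have key : ∀ c : ℤ, |d e - c| = |d e| - 1 → (d - Pi.single e c : E → ℤ) ∈ T := by
        intro c hc
        apply hmem
        have : ∀ x, |(d - Pi.single e c : E → ℤ) x| = |d x| - if x = e then 1 else 0 := by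
          intro x
          by_cases hx : x = e
          · subst hx; simpa using hc
          · simp [hx]
        simp only [this, Finset.sum_sub_distrib, Finset.sum_ite_eq', Finset.mem_univ, if_true]
        push_cast at hd
        linarith
      rcases lt_or_gt_of_ne he with hneg | hpos
      · refine Finset.mem_image₂.2 ⟨some (e, false), Finset.mem_univ _, _, key (-1) ?_,
          by simp [s]⟩
        have : d e < 0 := hneg
        rw [abs_of_nonpos (by linarith), abs_of_neg this]; ring
      · refine Finset.mem_image₂.2 ⟨some (e, true), Finset.mem_univ _, _, key 1 ?_, by simp [s]⟩
        have : 0 < d e := hpos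
        rw [abs_of_nonneg (by linarith), abs_of_pos this]

/-- By connectedness, v is determined by its value at a corner and its edge differences. There are 2
· 2^{2J} edges, loops included, hence the base 4 · 2^{2J} + 1. -/
lemma exists_finset_integer_variation (J K L : ℕ) :
    ∃ T : Finset (Grid J → ℤ), T.card ≤ (L + 1) * (4 * 2 ^ (2 * J) + 1) ^ K ∧
      ∀ v : Grid J → ℤ, (∀ k, 0 ≤ v k ∧ v k ≤ L) →
        ∑ e : Grid J × Bool, |v (tip e) - v e.1| ≤ K → v ∈ T := by
  classical
  obtain ⟨T, hT, hmem⟩ := exists_finset_l1_ball (Grid J × Bool) K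
  set o : Grid J := (⟨0, by positivity⟩, ⟨0, by positivity⟩)
  set A : Set (Grid J → ℤ) := {v | (∀ k, 0 ≤ v k ∧ v k ≤ L) ∧
    ∑ e : Grid J × Bool, |v (tip e) - v e.1| ≤ K} with hA
  set φ : (Grid J → ℤ) → ℤ × (Grid J × Bool → ℤ) := fun v => (v o, fun e => v (tip e) - v e.1)
  have hmaps : Set.MapsTo φ A ((Finset.Icc (0 : ℤ) L ×ˢ T : Finset _) : Set _) := by
    intro v hv
    simp only [Finset.coe_product, Set.mem_prod, Finset.mem_coe, Finset.mem_Icc, φ]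
    exact ⟨hv.1 o, hmem _ hv.2⟩
  have hinj : Set.InjOn φ A := by
    intro v _ w _ hvw
    have h0 : v o = w o := congrArg Prod.fst hvw
    have hd : ∀ e, v (tip e) - v e.1 = w (tip e) - w e.1 := fun e => congrFun (congrArg Prod.snd hvw) e
    have := eq_of_tip_eq (fun k => v k - w k) (fun e => by have := hd e; linarith)
    funext k
    have := this k o
    linarith
  have hfin : A.Finite := Set.Finite.of_injOn hmaps hinj (Finset.finite_toSet _)
  refine ⟨hfin.toFinset, ?_, fun v h1 h2 => hfin.mem_toFinset.2 ⟨h1, h2⟩⟩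
  have hcard : hfin.toFinset.card ≤ (Finset.Icc (0 : ℤ) L ×ˢ T).card :=
    Finset.card_le_card_of_injOn φ (by simpa using hmaps) (by simpa using hinj)
  refine hcard.trans ?_
  rw [Finset.card_product]
  refine Nat.mul_le_mul (by simp) (hT.trans (le_of_eq ?_))
  simp only [Fintype.card_prod, Fintype.card_fin, Fintype.card_bool]
  ring

/-! ### Rounding -/

lemma intervalIntegrable_floor (a : ℝ) :
    IntervalIntegrable (fun θ : ℝ => (⌊a + θ⌋ : ℝ)) volume 0 1 := by
  refine Monotone.intervalIntegrable fun x y hxy => ?_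
  exact_mod_cast Int.floor_mono (by linarith)

/-- The floor of c + θ is c + θ minus a 1-periodic function, whose integral over a period does not
depend on c. -/
lemma integral_floor_sub (a b : ℝ) :
    ∫ θ in (0 : ℝ)..1, ((⌊a + θ⌋ : ℝ) - ⌊b + θ⌋) = a - b := by
  have hper : ∀ c : ℝ, ∫ θ in (0 : ℝ)..1, (⌊c + θ⌋ : ℝ) =
      c + ∫ θ in (0 : ℝ)..1, (⌊θ⌋ : ℝ) := by
    intro c
    have hf : ∀ c, IntervalIntegrable (fun θ : ℝ => Int.fract (c + θ)) volume 0 1 := by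
      intro c
      have : (fun θ : ℝ => Int.fract (c + θ)) = fun θ => (c + θ) - (⌊c + θ⌋ : ℝ) := rfl
      rw [this]
      exact (Continuous.intervalIntegrable (by fun_prop) _ _).sub (intervalIntegrable_floor c)
    have h1 : ∀ c, ∫ θ in (0 : ℝ)..1, (⌊c + θ⌋ : ℝ) =
        (∫ θ in (0 : ℝ)..1, (c + θ)) - ∫ θ in (0 : ℝ)..1, Int.fract (c + θ) := by
      intro c
      rw [← intervalIntegral.integral_sub (Continuous.intervalIntegrable (by fun_prop) _ _) (hf c)]
      simp only [Int.fract, sub_sub_cancel]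
    have h2 : ∫ θ in (0 : ℝ)..1, Int.fract (c + θ) = ∫ θ in (0 : ℝ)..1, Int.fract (0 + θ) := by
      rw [intervalIntegral.integral_comp_add_left (fun θ : ℝ => Int.fract θ),
        intervalIntegral.integral_comp_add_left (fun θ : ℝ => Int.fract θ)]
      have hp : Function.Periodic (fun θ : ℝ => Int.fract θ) 1 := fun θ => Int.fract_add_one θ
      simpa using hp.intervalIntegral_add_eq c 0
    have h3 := h1 0
    simp only [zero_add] at h3 h2
    rw [h1 c, h2, h3]
    have h4 : ∫ θ in (0 : ℝ)..1, (c + θ) = c + ∫ θ in (0 : ℝ)..1, θ := by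
      rw [intervalIntegral.integral_add (by simp) (Continuous.intervalIntegrable (by fun_prop) _ _)]
      simp
    rw [h4]; ring
  rw [intervalIntegral.integral_sub (intervalIntegrable_floor a) (intervalIntegrable_floor b),
    hper a, hper b]
  ring

lemma integral_abs_floor_sub (a b : ℝ) :
    ∫ θ in (0 : ℝ)..1, |(⌊a + θ⌋ : ℝ) - ⌊b + θ⌋| = |a - b| := by
  wlog h : b ≤ a generalizing a b
  · rw [abs_sub_comm, ← this b a (le_of_not_ge h)]
    simp only [abs_sub_comm]
  rw [abs_of_nonneg (by linarith), ← integral_floor_sub]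
  congr 1
  ext θ
  rw [abs_of_nonneg]
  have : (⌊b + θ⌋ : ℝ) ≤ ⌊a + θ⌋ := by exact_mod_cast Int.floor_mono (by linarith)
  linarith

/-- With a uniformly random offset θ, the variation of ⌊u/r + θ⌋ has mean exactly that of u/r, so
some θ does no worse. A fixed offset could inflate small oscillations into full units. -/
lemma exists_rounding {J : ℕ} (u : Grid J → ℝ) (hu : ∀ k, 0 ≤ u k) {r : ℝ} (hr : 0 < r) :
    ∃ v : Grid J → ℤ, (∀ k, |r * v k - u k| ≤ r) ∧ (∀ k, 0 ≤ v k ∧ (v k : ℝ) ≤ u k / r + 1) ∧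
      ((∑ e : Grid J × Bool, |v (tip e) - v e.1| : ℤ) : ℝ) ≤ gridTV J u / r := by
  set G : ℝ → ℝ := fun θ =>
    ∑ e : Grid J × Bool, |(⌊u (tip e) / r + θ⌋ : ℝ) - ⌊u e.1 / r + θ⌋| with hG
  have hterm : ∀ e : Grid J × Bool, IntervalIntegrable
      (fun θ : ℝ => |(⌊u (tip e) / r + θ⌋ : ℝ) - ⌊u e.1 / r + θ⌋|) volume 0 1 := fun e =>
    ((intervalIntegrable_floor _).sub (intervalIntegrable_floor _)).abs
  have hint : ∫ θ in (0 : ℝ)..1, G θ = gridTV J u / r := by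
    rw [hG, intervalIntegral.integral_finsetSum fun e _ => hterm e, gridTV_eq, Finset.sum_div]
    refine Finset.sum_congr rfl fun e _ => ?_
    rw [integral_abs_floor_sub, ← sub_div, abs_div, abs_of_pos hr]
  have hGi : IntervalIntegrable G volume 0 1 := by
    have := IntervalIntegrable.sum (Finset.univ) (fun e _ => hterm e)
    have hGe : G = ∑ e : Grid J × Bool,
        fun θ : ℝ => |(⌊u (tip e) / r + θ⌋ : ℝ) - ⌊u e.1 / r + θ⌋| := by
      funext θ; simp [hG]
    rwa [hGe]
  obtain ⟨θ, hθ, hle⟩ := exists_le_setAverage (μ := volume) (s := Set.Ioc (0 : ℝ) 1) (f := G)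
    (by simp) (by simp) ((intervalIntegrable_iff_integrableOn_Ioc_of_le zero_le_one).1 hGi)
  rw [setAverage_eq, ← intervalIntegral.integral_of_le zero_le_one, hint] at hle
  simp only [Real.volume_real_Ioc, sub_zero, max_eq_left, zero_le_one, inv_one, one_smul] at hle
  refine ⟨fun k => ⌊u k / r + θ⌋, fun k => ?_, fun k => ⟨?_, ?_⟩, ?_⟩
  · have h1 := Int.floor_le (u k / r + θ)
    have h2 := Int.lt_floor_add_one (u k / r + θ)
    have h3 : u k = r * (u k / r) := by field_simp
    have : r * (⌊u k / r + θ⌋ : ℝ) - u k = r * (⌊u k / r + θ⌋ - u k / r) := by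
      rw [mul_sub, ← h3]
    rw [this, abs_mul, abs_of_pos hr]
    refine mul_le_of_le_one_right hr.le (abs_le.2 ⟨?_, ?_⟩) <;> linarith [hθ.1, hθ.2]
  · exact Int.floor_nonneg.2 (add_nonneg (div_nonneg (hu k) hr.le) hθ.1.le)
  · exact (Int.floor_le _).trans (by linarith [hθ.2])
  · push_cast
    exact hle

/-! ### Sampling without replacement -/

/-- The binomial law with success probability m/N, multiplied by N^N, peaks at m: the ratio of
consecutive terms is (N-i)m / ((i+1)(N-m)), which is at least 1 below m and at most 1 from m on. -/
lemma choose_mul_pow_le_mode {N m j : ℕ} (hm : m ≤ N) (hj : j ≤ N) :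
    N.choose j * m ^ j * (N - m) ^ (N - j) ≤ N.choose m * m ^ m * (N - m) ^ (N - m) := by
  set a : ℕ → ℕ := fun j => N.choose j * m ^ j * (N - m) ^ (N - j) with ha
  have hrec : ∀ i < N, a (i + 1) * ((i + 1) * (N - m)) = a i * ((N - i) * m) := by
    intro i hi
    have h1 := Nat.choose_succ_right_eq N i
    have h2 : (N - m) ^ (N - i) = (N - m) ^ (N - (i + 1)) * (N - m) := by
      rw [← pow_succ]; congr 1; omega
    simp only [ha]
    rw [h2, pow_succ]
    calc _ = (N.choose (i + 1) * (i + 1)) * (m ^ i * m * (N - m) ^ (N - (i + 1)) * (N - m)) := by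
          ring
      _ = _ := by rw [h1]; ring
  change a j ≤ a m
  rcases le_total j m with hjm | hjm
  · induction hjm using Nat.decreasingInduction with
    | self => exact le_rfl
    | of_succ i hi ih =>
      have hiN : i < N := by omega
      refine le_trans ?_ (ih hiN)
      have hpos : 0 < (N - i) * m := Nat.mul_pos (by omega) (by omega)
      refine Nat.le_of_mul_le_mul_right ?_ hpos
      rw [← hrec i hiN]
      refine Nat.mul_le_mul_left _ ?_
      zify [hm, hiN.le]
      have h3 : ((i : ℤ) + 1) ≤ m := by exact_mod_cast hi
      have h4 : (0 : ℤ) ≤ N := by positivity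
      have h5 : (0 : ℤ) ≤ m := by positivity
      nlinarith [mul_le_mul_of_nonneg_right h3 h4]
  · induction j, hjm using Nat.le_induction with
    | base => exact le_rfl
    | succ i hi ih =>
      refine le_trans ?_ (ih (by omega))
      have hiN : i < N := by omega
      have hpos : 0 < (i + 1) * (N - m) := Nat.mul_pos (by omega) (by omega)
      refine Nat.le_of_mul_le_mul_right ?_ hpos
      rw [hrec i hiN]
      refine Nat.mul_le_mul_left _ ?_
      zify [hm, hiN.le]
      have h3 : (m : ℤ) ≤ i := by exact_mod_cast hi
      have h4 : (0 : ℤ) ≤ N := by positivity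
      have h5 : (m : ℤ) ≤ N := by exact_mod_cast hm
      nlinarith [mul_le_mul_of_nonneg_right h3 h4]

/-- The N + 1 binomial probabilities sum to 1 and the one at m is the largest. -/
lemma one_le_mode {N m : ℕ} (hN : 0 < N) (hm : m ≤ N) :
    (1 : ℝ) ≤ (N + 1) * N.choose m * ((m / N : ℝ) ^ m * (1 - m / N : ℝ) ^ (N - m)) := by
  have h : N ^ N ≤ (N + 1) * (N.choose m * m ^ m * (N - m) ^ (N - m)) := by
    calc N ^ N = (m + (N - m)) ^ N := by congr 1; omega
      _ = ∑ j ∈ Finset.range (N + 1), m ^ j * (N - m) ^ (N - j) * N.choose j := add_pow _ _ _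
      _ ≤ ∑ j ∈ Finset.range (N + 1), N.choose m * m ^ m * (N - m) ^ (N - m) := by
          refine Finset.sum_le_sum fun j hj => ?_
          have := choose_mul_pow_le_mode hm (Nat.lt_succ_iff.1 (Finset.mem_range.1 hj))
          linarith
      _ = _ := by simp
  have hN' : (0 : ℝ) < N := by exact_mod_cast hN
  have h' : (N : ℝ) ^ N ≤ (N + 1) * (N.choose m * m ^ m * (N - m : ℝ) ^ (N - m)) := by
    rw [← Nat.cast_sub hm]; exact_mod_cast h
  have hsplit : (N : ℝ) ^ N = N ^ m * N ^ (N - m) := by rw [← pow_add]; congr 1; omega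
  have h1 : (1 - m / N : ℝ) = (N - m) / N := by field_simp
  rw [h1, div_pow, div_pow, div_mul_div_comm, ← hsplit, ← mul_div_assoc, le_div_iff₀ (by positivity),
    one_mul]
  linarith

/-- Comparison with independent selection at rate p = m/N, where the mean of the product factorizes
into ∏ (pY + 1 - p). Conditioning on exactly m selected points costs at most the factor N + 1 of
`one_le_mode`. -/
lemma sum_powersetCard_prod_le {ι : Type*} [Fintype ι] [DecidableEq ι] {m : ℕ}
    (hN : 0 < Fintype.card ι) (hm : m ≤ Fintype.card ι) {Y : ι → ℝ} (hY : ∀ k, 0 ≤ Y k) :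
    ∑ S ∈ (Finset.univ : Finset ι).powersetCard m, ∏ k ∈ S, Y k ≤
      (Fintype.card ι + 1) * (Fintype.card ι).choose m *
        Real.exp (-((m / Fintype.card ι : ℝ) * ∑ k, (1 - Y k))) := by
  set N := Fintype.card ι
  set p : ℝ := m / N with hp
  have hN' : (0 : ℝ) < N := by exact_mod_cast hN
  have hp0 : 0 ≤ p := by positivity
  have hp1 : 0 ≤ 1 - p := by
    rw [hp, sub_nonneg, div_le_one hN']; exact_mod_cast hm
  set e := ∑ S ∈ (Finset.univ : Finset ι).powersetCard m, ∏ k ∈ S, Y k with he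
  have he0 : 0 ≤ e := Finset.sum_nonneg fun S _ => Finset.prod_nonneg fun k _ => hY k
  have h1 : p ^ m * (1 - p) ^ (N - m) * e ≤ ∏ k, (p * Y k + (1 - p)) := by
    rw [Finset.prod_add, he, Finset.mul_sum]
    calc ∑ S ∈ (Finset.univ : Finset ι).powersetCard m, p ^ m * (1 - p) ^ (N - m) * ∏ k ∈ S, Y k
        = ∑ S ∈ (Finset.univ : Finset ι).powersetCard m,
            (∏ k ∈ S, p * Y k) * ∏ k ∈ Finset.univ \ S, (1 - p) := by
          refine Finset.sum_congr rfl fun S hS => ?_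
          rw [Finset.mem_powersetCard] at hS
          rw [Finset.prod_mul_distrib, Finset.prod_const, Finset.prod_const, hS.2,
            Finset.card_sdiff_of_subset hS.1, hS.2, Finset.card_univ]
          ring
      _ ≤ _ := by
          refine Finset.sum_le_sum_of_subset_of_nonneg
            (fun S hS => Finset.mem_powerset.2 (Finset.mem_powersetCard.1 hS).1) fun S _ _ => ?_
          exact mul_nonneg (Finset.prod_nonneg fun k _ => mul_nonneg hp0 (hY k))
            (Finset.prod_nonneg fun _ _ => hp1)
  have h2 : ∏ k, (p * Y k + (1 - p)) ≤ Real.exp (-(p * ∑ k, (1 - Y k))) := by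
    rw [Finset.mul_sum, ← Finset.sum_neg_distrib, Real.exp_sum]
    refine Finset.prod_le_prod (fun k _ => by have := mul_nonneg hp0 (hY k); linarith) fun k _ => ?_
    have := Real.add_one_le_exp (-(p * (1 - Y k)))
    linarith
  have h3 := one_le_mode hN hm
  calc e ≤ ((N + 1) * N.choose m * (p ^ m * (1 - p) ^ (N - m))) * e :=
        le_mul_of_one_le_left he0 h3
    _ = (N + 1) * N.choose m * (p ^ m * (1 - p) ^ (N - m) * e) := by ring
    _ ≤ _ := by gcongr; exact h1.trans h2

/-- The slope 3/4 is the source of the constant 16/3 in the theorem. -/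
lemma exp_neg_le_one_sub {y : ℝ} (h0 : 0 ≤ y) (h1 : y ≤ 1 / 2) :
    Real.exp (-y) ≤ 1 - 3 / 4 * y := by
  have h := Real.quadratic_le_exp_of_nonneg h0
  rw [Real.exp_neg, inv_le_comm₀ (Real.exp_pos _) (by linarith)]
  refine le_trans ?_ h
  rw [inv_le_iff_one_le_mul₀ (by linarith)]
  nlinarith [mul_nonneg h0 h0, mul_nonneg h0 (sub_nonneg.2 h1),
    mul_nonneg (mul_nonneg h0 h0) (sub_nonneg.2 h1)]

/-- A lower tail bound for the sum over a random subset of given size. -/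
lemma card_filter_sum_le {ι : Type*} [Fintype ι] [DecidableEq ι] {m : ℕ}
    (hN : 0 < Fintype.card ι) (hm : m ≤ Fintype.card ι) {X : ι → ℝ} {B : ℝ} (hB : 0 < B)
    (hX : ∀ k, 0 ≤ X k ∧ X k ≤ B) (t : ℝ) :
    ((((Finset.univ : Finset ι).powersetCard m).filter fun S =>
        ∑ k ∈ S, X k ≤ m * (3 / 4 * ((∑ k, X k) / Fintype.card ι) - t)).card : ℝ) ≤
      (Fintype.card ι + 1) * (Fintype.card ι).choose m * Real.exp (-(m * t / (2 * B))) := by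
  set N := Fintype.card ι
  have hN' : (0 : ℝ) < N := by exact_mod_cast hN
  set a : ℝ := m * (3 / 4 * ((∑ k, X k) / N) - t) with ha
  -- Chernoff parameter: it keeps l X ≤ 1/2, the range of `exp_neg_le_one_sub`.
  set l : ℝ := 1 / (2 * B) with hl
  have hl0 : 0 < l := by positivity
  set Y : ι → ℝ := fun k => Real.exp (-(l * X k)) with hY
  have hY1 : ∀ k, 3 / 4 * (l * X k) ≤ 1 - Y k := by
    intro k
    have h1 : l * X k ≤ 1 / 2 := by
      rw [hl, one_div, inv_mul_le_iff₀ (by positivity)]; linarith [(hX k).2]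
    have := exp_neg_le_one_sub (mul_nonneg hl0.le (hX k).1) h1
    simp only [hY]; linarith
  have hsum : 3 / 4 * l * ∑ k, X k ≤ ∑ k, (1 - Y k) := by
    rw [Finset.mul_sum]
    exact Finset.sum_le_sum fun k _ => by linarith [hY1 k]
  calc ((((Finset.univ : Finset ι).powersetCard m).filter fun S => ∑ k ∈ S, X k ≤ a).card : ℝ)
      = ∑ S ∈ ((Finset.univ : Finset ι).powersetCard m).filter (fun S => ∑ k ∈ S, X k ≤ a), 1 := by
        simp
    _ ≤ ∑ S ∈ ((Finset.univ : Finset ι).powersetCard m).filter (fun S => ∑ k ∈ S, X k ≤ a),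
          Real.exp (l * a) * ∏ k ∈ S, Y k := by
        refine Finset.sum_le_sum fun S hS => ?_
        rw [hY, ← Real.exp_sum, ← Real.exp_add, Finset.sum_neg_distrib, ← Finset.mul_sum]
        apply Real.one_le_exp
        have := mul_le_mul_of_nonneg_left (Finset.mem_filter.1 hS).2 hl0.le
        linarith
    _ ≤ ∑ S ∈ (Finset.univ : Finset ι).powersetCard m, Real.exp (l * a) * ∏ k ∈ S, Y k :=
        Finset.sum_le_sum_of_subset_of_nonneg (Finset.filter_subset _ _) fun S _ _ =>
          mul_nonneg (Real.exp_pos _).le (Finset.prod_nonneg fun k _ => (Real.exp_pos _).le)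
    _ ≤ Real.exp (l * a) * ((N + 1) * N.choose m * Real.exp (-((m / N : ℝ) * ∑ k, (1 - Y k)))) := by
        rw [← Finset.mul_sum]
        exact mul_le_mul_of_nonneg_left
          (sum_powersetCard_prod_le hN hm fun k => (Real.exp_pos _).le) (Real.exp_pos _).le
    _ = (N + 1) * N.choose m * Real.exp (l * a - (m / N : ℝ) * ∑ k, (1 - Y k)) := by
        rw [sub_eq_add_neg, Real.exp_add]; ring
    _ ≤ (N + 1) * N.choose m * Real.exp (-(m * t / (2 * B))) := by
        gcongr
        have h1 : (m / N : ℝ) * (3 / 4 * l * ∑ k, X k) ≤ (m / N : ℝ) * ∑ k, (1 - Y k) := by gcongr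
        have h2 : l * a = (m / N : ℝ) * (3 / 4 * l * ∑ k, X k) - m * t / (2 * B) := by
          rw [ha, hl]; field_simp
        linarith

/-! ### The discrete error bound -/

lemma le_subsetProb {ι : Type*} [Fintype ι] {m : ℕ} (hm : m ≤ Fintype.card ι)
    {E : Finset ι → Prop} {δ : ℝ} (T : Finset (Finset ι))
    (hT : (T.card : ℝ) ≤ δ * (Fintype.card ι).choose m)
    (h : ∀ S : Finset ι, S.card = m → S ∉ T → E S) : 1 - δ ≤ subsetProb m E := by
  classical
  have hC : (0 : ℝ) < (Fintype.card ι).choose m := by exact_mod_cast Nat.choose_pos hm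
  unfold subsetProb
  rw [Finset.card_powersetCard, Finset.card_univ, le_div_iff₀ hC]
  have h1 : (Finset.univ : Finset ι).powersetCard m ⊆
      (((Finset.univ : Finset ι).powersetCard m).filter E) ∪ T := by
    intro S hS
    by_cases hST : S ∈ T
    · exact Finset.mem_union_right _ hST
    · exact Finset.mem_union_left _
        (Finset.mem_filter.2 ⟨hS, h S (Finset.mem_powersetCard.1 hS).2 hST⟩)
  have h2 := (Finset.card_le_card h1).trans (Finset.card_union_le _ _)
  rw [Finset.card_powersetCard, Finset.card_univ] at h2
  have h3 : ((Fintype.card ι).choose m : ℝ) ≤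
      (((Finset.univ : Finset ι).powersetCard m).filter E).card + T.card := by exact_mod_cast h2
  have h4 : (((Finset.univ : Finset ι).powersetCard m).filter E).card =
    (@Finset.filter (Finset ι) E (fun a => Classical.propDecidable _)
      ((Finset.univ : Finset ι).powersetCard m)).card := by congr
  rw [h4] at h3
  linarith

lemma two_pow_le_exp (n : ℕ) : (2 : ℝ) ^ n ≤ Real.exp n := by
  have h : (2 : ℝ) ≤ Real.exp 1 := by linarith [Real.add_one_le_exp 1]
  calc (2 : ℝ) ^ n ≤ Real.exp 1 ^ n := by gcongr
    _ = Real.exp n := by rw [← Real.exp_nat_mul, mul_one]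

/-- The factors are the two of the candidate count, the loss N + 1 of the sampling comparison, and
the inverse failure probability N. Their shares of the exponent are M + 1, 5V, 3 and 2, using that
1/R, J and 2^J J / R are at most Q. -/
lemma entropy_le_exp {J : ℕ} (hJ : 1 ≤ J) {M V R Q : ℝ} (hM : 0 ≤ M) (hV : 0 ≤ V) (hR : 0 < R)
    (hR1 : R < 1) (hQ : Q = 2 ^ J * (J : ℝ) ^ 3 / R) :
    ((⌊M / R + 1⌋₊ : ℝ) + 1) * (4 * 2 ^ (2 * J) + 1) ^ ⌊2 ^ J * V / R⌋₊ *
        (2 ^ (2 * J) + 1) * 2 ^ (2 * J) ≤ Real.exp ((5 * V + M + 6) * Q) := by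
  have hJr : (1 : ℝ) ≤ J := by exact_mod_cast hJ
  have h2J : (1 : ℝ) ≤ 2 ^ J := one_le_pow₀ (by norm_num)
  have hRi : 1 ≤ 1 / R := by rw [le_div_iff₀ hR]; linarith
  have hJ3 : (J : ℝ) ≤ (J : ℝ) ^ 3 := le_self_pow₀ hJr (by norm_num)
  have hQR : 1 / R ≤ Q := by
    rw [hQ, div_le_div_iff_of_pos_right hR]
    exact one_le_mul_of_one_le_of_one_le h2J (hJr.trans hJ3)
  have hQJ : J ≤ Q := by
    rw [hQ, le_div_iff₀ hR]
    calc (J : ℝ) * R ≤ J * 1 := by gcongr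
      _ ≤ 1 * (J : ℝ) ^ 3 := by linarith
      _ ≤ 2 ^ J * (J : ℝ) ^ 3 := by gcongr
  have hQV : J * (2 ^ J * V / R) ≤ V * Q := by
    rw [hQ]
    calc J * (2 ^ J * V / R) = V * (2 ^ J * J / R) := by ring
      _ ≤ V * (2 ^ J * (J : ℝ) ^ 3 / R) := by gcongr
  have hN : (2 : ℝ) ^ (2 * J) ≤ Real.exp (2 * J) := by
    have := two_pow_le_exp (2 * J); push_cast at this; exact this
  have hN1 : (1 : ℝ) ≤ 2 ^ (2 * J) := one_le_pow₀ (by norm_num)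
  have e1 : ((⌊M / R + 1⌋₊ : ℝ) + 1) ≤ Real.exp ((M + 1) * Q) := by
    have h1 : (⌊M / R + 1⌋₊ : ℝ) ≤ M / R + 1 := Nat.floor_le (by positivity)
    have h2 : M / R + 1 ≤ (M + 1) * Q := by
      have : M / R = M * (1 / R) := by ring
      rw [this, add_mul, one_mul]
      exact add_le_add (by gcongr) (hRi.trans hQR)
    linarith [Real.add_one_le_exp ((M + 1) * Q)]
  have e2 : (4 * 2 ^ (2 * J) + 1 : ℝ) ≤ Real.exp (5 * J) := by
    calc (4 * 2 ^ (2 * J) + 1 : ℝ) ≤ 2 ^ 3 * 2 ^ (2 * J) := by linarith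
      _ ≤ Real.exp (3 : ℕ) * Real.exp (2 * J) := by gcongr; exact two_pow_le_exp 3
      _ = Real.exp (3 + 2 * J) := by rw [← Real.exp_add]; norm_num
      _ ≤ Real.exp (5 * J) := Real.exp_le_exp.2 (by linarith)
  have e3 : (4 * 2 ^ (2 * J) + 1 : ℝ) ^ ⌊2 ^ J * V / R⌋₊ ≤ Real.exp (5 * V * Q) := by
    calc (4 * 2 ^ (2 * J) + 1 : ℝ) ^ ⌊2 ^ J * V / R⌋₊ ≤ Real.exp (5 * J) ^ ⌊2 ^ J * V / R⌋₊ := by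
          gcongr
      _ = Real.exp (⌊2 ^ J * V / R⌋₊ * (5 * J)) := by rw [Real.exp_nat_mul]
      _ ≤ Real.exp (5 * V * Q) := by
          apply Real.exp_le_exp.2
          have h1 : (⌊2 ^ J * V / R⌋₊ : ℝ) ≤ 2 ^ J * V / R := Nat.floor_le (by positivity)
          calc (⌊2 ^ J * V / R⌋₊ : ℝ) * (5 * J) ≤ (2 ^ J * V / R) * (5 * J) := by gcongr
            _ = 5 * (J * (2 ^ J * V / R)) := by ring
            _ ≤ 5 * V * Q := by linarith
  have e4 : (2 ^ (2 * J) + 1 : ℝ) ≤ Real.exp (3 * Q) := by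
    calc (2 ^ (2 * J) + 1 : ℝ) ≤ 2 ^ 1 * 2 ^ (2 * J) := by linarith
      _ ≤ Real.exp (1 : ℕ) * Real.exp (2 * J) := by gcongr; exact two_pow_le_exp 1
      _ = Real.exp (1 + 2 * J) := by rw [← Real.exp_add]; norm_num
      _ ≤ _ := Real.exp_le_exp.2 (by linarith)
  have e5 : (2 ^ (2 * J) : ℝ) ≤ Real.exp (2 * Q) := hN.trans (Real.exp_le_exp.2 (by linarith))
  calc _ ≤ Real.exp ((M + 1) * Q) * Real.exp (5 * V * Q) * Real.exp (3 * Q) * Real.exp (2 * Q) := by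
        gcongr
    _ = _ := by
        rw [← Real.exp_add, ← Real.exp_add, ← Real.exp_add]; congr 1; ring

lemma card_grid (J : ℕ) : Fintype.card (Grid J) = 2 ^ (2 * J) := by
  simp only [Fintype.card_prod, Fintype.card_fin]; ring

lemma abs_sq_sub_sq_le {x y r M : ℝ} (hr : 0 ≤ r) (hxy : |x - y| ≤ r) (hx : |x| ≤ M + 1)
    (hy : |y| ≤ M) : |x ^ 2 - y ^ 2| ≤ r * (2 * M + 1) := by
  rw [sq_sub_sq, abs_mul, mul_comm]
  exact mul_le_mul hxy ((abs_add_le _ _).trans (by linarith)) (abs_nonneg _) hr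

/-- The constant in the discrete error bound, for values in `[0, M]` and total variation `V`. -/
def errorConst (M V : ℝ) : ℝ :=
  -- M² serves the case R ≥ 1. The rounding error enters once on the full grid and 4/3 times through
  -- the sample, giving 7/3. The last term is the deviation t divided by 3R/4.
  M ^ 2 + 7 / 3 * (2 * M + 1) + 4 / 3 * (2 * (M + 1) ^ 2 * (5 * V + M + 6))

lemma sum_sq_le_of_feasible {J : ℕ} {S : Finset (Grid J)} (hS : S.Nonempty) {M η : ℝ}
    {a g ε u : Grid J → ℝ} (hg : ∀ k, g k = a k + ε k) (hadm : IsAdmissible S M η g ε)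
    (hu : IsFeasible S g η u) : ∑ k ∈ S, (u k - a k) ^ 2 ≤ S.card * (4 * η ^ 2) := by
  have hc : (0 : ℝ) < S.card := by exact_mod_cast hS.card_pos
  have h1 := hadm.noise_le
  have h2 := hu
  unfold IsFeasible at h2
  unfold average at h1 h2
  rw [one_div, inv_mul_le_iff₀ hc] at h1 h2
  calc ∑ k ∈ S, (u k - a k) ^ 2 ≤ ∑ k ∈ S, (2 * |u k - g k| ^ 2 + 2 * |ε k| ^ 2) := by
        refine Finset.sum_le_sum fun k _ => ?_
        rw [sq_abs, sq_abs, hg k]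
        nlinarith [sq_nonneg (u k - (a k + ε k) - ε k)]
    _ ≤ _ := by
        rw [Finset.sum_add_distrib, ← Finset.mul_sum, ← Finset.mul_sum]
        linarith

/-- R is at once the rounding step, the order of the admitted deviation and the final rate; `hRm`
balances the entropy of the rounded functions against the Chernoff exponent. -/
theorem discrete_bound {J m : ℕ} (hJ : 1 ≤ J) (hm1 : 1 ≤ m) (hm : m ≤ 2 ^ (2 * J)) {M V R η : ℝ}
    (hM : 0 ≤ M) (hV : 0 ≤ V) (hR : 0 < R) (hRm : R ^ 2 * m = 2 ^ J * (J : ℝ) ^ 3)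
    {a g ε : Grid J → ℝ} (ha : ∀ k, a k ∈ Set.Icc 0 M) (hTV : gridTV J a ≤ 2 ^ J * V)
    (hg : ∀ k, g k = a k + ε k) :
    1 - ((2 : ℝ) ^ (2 * J))⁻¹ ≤ subsetProb m (fun S : Finset (Grid J) =>
      IsAdmissible S M η g ε → ∀ u, IsTVSolution S g η u →
        1 / (2 : ℝ) ^ (2 * J) * ∑ k, |u k - a k| ^ 2 ≤ errorConst M V * R + 16 / 3 * η ^ 2) := by
  classical
  set N : ℝ := 2 ^ (2 * J) with hN
  have hNpos : 0 < N := by positivity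
  have hcard : (Fintype.card (Grid J) : ℝ) = N := by rw [card_grid, hN]; push_cast; rfl
  have hm' : m ≤ Fintype.card (Grid J) := by rwa [card_grid]
  have hmr : (0 : ℝ) < m := by exact_mod_cast hm1
  have huM : ∀ S : Finset (Grid J), S.card = m → IsAdmissible S M η g ε → ∀ u,
      IsTVSolution S g η u → ∀ k, |u k - a k| ≤ M ∧ u k ∈ Set.Icc 0 M := by
    intro S hS hadm u hu k
    have hne : S.Nonempty := Finset.card_pos.1 (by omega)
    have h1 := hu.mem_Icc hne hM hadm k
    exact ⟨abs_le.2 ⟨by linarith [h1.1, (ha k).2], by linarith [h1.2, (ha k).1]⟩, h1⟩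
  have hP : 0 ≤ 4 / 3 * (2 * (M + 1) ^ 2 * (5 * V + M + 6)) := by positivity
  rcases le_or_gt 1 R with hR1 | hR1
  -- For R ≥ 1 the bound |u - a| ≤ M suffices and no set is exceptional.
  · refine le_subsetProb hm' ∅ (by rw [Finset.card_empty, Nat.cast_zero]; positivity) fun S hS _ hadm u hu => ?_
    have h1 : ∑ k, |u k - a k| ^ 2 ≤ N * M ^ 2 := by
      rw [← hcard, ← nsmul_eq_mul, ← Finset.card_univ]
      exact Finset.sum_le_card_nsmul _ _ _ fun k _ =>
        pow_le_pow_left₀ (abs_nonneg _) (huM S hS hadm u hu k).1 2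
    have h2 : 1 / N * ∑ k, |u k - a k| ^ 2 ≤ M ^ 2 := by
      rw [one_div, inv_mul_le_iff₀ hNpos]; exact h1
    have h3 : M ^ 2 ≤ errorConst M V := by unfold errorConst; linarith
    have h4 : errorConst M V ≤ errorConst M V * R :=
      le_mul_of_one_le_right ((sq_nonneg M).trans h3) hR1
    linarith [sq_nonneg η]
  -- Rounding moves u by at most R < 1 and |u - a| ≤ M, so B bounds the squares (Rv - a)².
  set B : ℝ := (M + 1) ^ 2 with hB
  have hBpos : 0 < B := by positivity
  -- By `hRm`, the exponent m t / (2B) is then exactly the one in `entropy_le_exp`.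
  set t : ℝ := 2 * B * (5 * V + M + 6) * R with ht
  set K := ⌊2 ^ J * V / R⌋₊ with hK
  set L := ⌊M / R + 1⌋₊ with hL
  obtain ⟨T, hTc, hT⟩ := exists_finset_integer_variation J K L
  set T' := T.filter fun v => ∀ k, |R * v k - a k| ≤ M + 1
  set bad : (Grid J → ℤ) → Finset (Finset (Grid J)) := fun v =>
    ((Finset.univ : Finset (Grid J)).powersetCard m).filter fun S =>
      ∑ k ∈ S, (R * v k - a k) ^ 2 ≤
        m * (3 / 4 * ((∑ k, (R * v k - a k) ^ 2) / Fintype.card (Grid J)) - t) with hbad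
  refine le_subsetProb hm' (T'.biUnion bad) ?_ fun S hS hSb hadm u hu => ?_
  · have h1 : ∀ v ∈ T', ((bad v).card : ℝ) ≤
        (N + 1) * (Fintype.card (Grid J)).choose m * Real.exp (-(m * t / (2 * B))) := by
      intro v hv
      rw [← hcard]
      refine card_filter_sum_le (by rw [card_grid]; positivity) hm' hBpos (fun k => ⟨sq_nonneg _, ?_⟩) t
      rw [hB, ← sq_abs]
      exact pow_le_pow_left₀ (abs_nonneg _) ((Finset.mem_filter.1 hv).2 k) 2
    have hexp : m * t / (2 * B) = (5 * V + M + 6) * (2 ^ J * (J : ℝ) ^ 3 / R) := by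
      rw [← hRm, ht]; field_simp
    have h2 := entropy_le_exp hJ hM hV hR hR1 rfl
    have hTc' : (T'.card : ℝ) ≤ ((L : ℝ) + 1) * (4 * N + 1) ^ K := by
      have : T'.card ≤ (L + 1) * (4 * 2 ^ (2 * J) + 1) ^ K :=
        (Finset.card_filter_le _ _).trans hTc
      rw [hN]; exact_mod_cast this
    have h3 : ((L : ℝ) + 1) * (4 * N + 1) ^ K * (N + 1) * Real.exp (-(m * t / (2 * B))) ≤ N⁻¹ := by
      rw [Real.exp_neg, hexp, ← div_eq_mul_inv, div_le_iff₀ (Real.exp_pos _), inv_mul_eq_div,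
        le_div_iff₀ hNpos]
      exact h2
    calc ((T'.biUnion bad).card : ℝ) ≤ ∑ v ∈ T', ((bad v).card : ℝ) := by
          exact_mod_cast Finset.card_biUnion_le
      _ ≤ T'.card * ((N + 1) * (Fintype.card (Grid J)).choose m *
            Real.exp (-(m * t / (2 * B)))) := by
          rw [← nsmul_eq_mul]; exact Finset.sum_le_card_nsmul _ _ _ h1
      _ ≤ (((L : ℝ) + 1) * (4 * N + 1) ^ K) * ((N + 1) * (Fintype.card (Grid J)).choose m *
            Real.exp (-(m * t / (2 * B)))) := by gcongr
      _ = (((L : ℝ) + 1) * (4 * N + 1) ^ K * (N + 1) * Real.exp (-(m * t / (2 * B)))) *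
            (Fintype.card (Grid J)).choose m := by ring
      _ ≤ _ := by gcongr
  · have hne : S.Nonempty := Finset.card_pos.1 (by omega)
    have hrange := huM S hS hadm u hu
    have hfeas : IsFeasible S g η a := by
      refine le_trans (le_of_eq ?_) hadm.noise_le
      simp [hg]
    have huTV : gridTV J u ≤ 2 ^ J * V := (hu.2 a hfeas).trans hTV
    obtain ⟨v, hv1, hv2, hv3⟩ := exists_rounding u (fun k => (hrange k).2.1) hR
    have hvT : v ∈ T := by
      refine hT v (fun k => ⟨(hv2 k).1, ?_⟩) ?_
      · rw [hL, Int.natCast_floor_eq_floor (by positivity)]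
        refine Int.le_floor.2 ((hv2 k).2.trans ?_)
        gcongr
        exact (hrange k).2.2
      · rw [hK, Int.natCast_floor_eq_floor (by positivity)]
        refine Int.le_floor.2 (hv3.trans ?_)
        gcongr
    have hvb : ∀ k, |R * v k - a k| ≤ M + 1 := by
      intro k
      have := abs_sub_le (R * v k) (u k) (a k)
      linarith [hv1 k, (hrange k).1]
    -- The rounding v of u is one of the finitely many candidates fixed before `S` is drawn, so the
    -- tail bound holds for it although u depends on `S`.
    have hnot : S ∉ bad v := fun h =>
      hSb (Finset.mem_biUnion.2 ⟨v, Finset.mem_filter.2 ⟨hvT, hvb⟩, h⟩)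
    have hlt : m * (3 / 4 * ((∑ k, (R * v k - a k) ^ 2) / N) - t) < ∑ k ∈ S, (R * v k - a k) ^ 2 := by
      by_contra! hc
      refine hnot (Finset.mem_filter.2 ⟨Finset.mem_powersetCard.2 ⟨Finset.subset_univ _, hS⟩, ?_⟩)
      rw [hcard]; exact hc
    have hclose : ∀ k, |(R * v k - a k) ^ 2 - (u k - a k) ^ 2| ≤ R * (2 * M + 1) := fun k =>
      abs_sq_sub_sq_le hR.le (by rw [sub_sub_sub_cancel_right]; exact hv1 k) (hvb k) (hrange k).1
    have hS1 : ∑ k ∈ S, (R * v k - a k) ^ 2 ≤ m * (4 * η ^ 2) + m * (R * (2 * M + 1)) := by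
      have h1 := sum_sq_le_of_feasible hne hg hadm hu.1
      rw [hS] at h1
      have h2 : ∑ k ∈ S, (R * v k - a k) ^ 2 ≤ ∑ k ∈ S, ((u k - a k) ^ 2 + R * (2 * M + 1)) :=
        Finset.sum_le_sum fun k _ => by linarith [(abs_le.1 (hclose k)).2]
      rw [Finset.sum_add_distrib, Finset.sum_const, hS, nsmul_eq_mul] at h2
      linarith
    have hS2 : ∑ k, |u k - a k| ^ 2 ≤ ∑ k, (R * v k - a k) ^ 2 + N * (R * (2 * M + 1)) := by
      have h2 : ∑ k, |u k - a k| ^ 2 ≤ ∑ k, ((R * v k - a k) ^ 2 + R * (2 * M + 1)) :=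
        Finset.sum_le_sum fun k _ => by rw [sq_abs]; linarith [(abs_le.1 (hclose k)).1]
      rwa [Finset.sum_add_distrib, Finset.sum_const, Finset.card_univ, nsmul_eq_mul, hcard] at h2
    have h3 : 3 / 4 * ((∑ k, (R * v k - a k) ^ 2) / N) - t < 4 * η ^ 2 + R * (2 * M + 1) := by
      have := hlt.trans_le hS1
      rw [← mul_add] at this
      exact lt_of_mul_lt_mul_left this hmr.le
    have h4 : 1 / N * ∑ k, |u k - a k| ^ 2 ≤
        (∑ k, (R * v k - a k) ^ 2) / N + R * (2 * M + 1) := by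
      rw [one_div, inv_mul_le_iff₀ hNpos, mul_add, mul_div_cancel₀ _ hNpos.ne']
      exact hS2
    have h5 : errorConst M V * R = M ^ 2 * R + 7 / 3 * (R * (2 * M + 1)) + 4 / 3 * t := by
      rw [ht, hB, errorConst]; ring
    rw [h5]
    have : 0 ≤ M ^ 2 * R := by positivity
    linarith

/-! ### Periodized hat functions -/

lemma hat_nonneg (x : ℝ) : 0 ≤ hat x := le_max_right _ _

lemma hat_le_one (x : ℝ) : hat x ≤ 1 := max_le (by linarith [abs_nonneg x]) zero_le_one

lemma hat_eq_zero {x : ℝ} (h : 1 ≤ |x|) : hat x = 0 := max_eq_right (by linarith)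

lemma continuous_hat : Continuous hat := by unfold hat; fun_prop

/-- The restriction to `[0, 1)` of the 1-periodization of `t ↦ hat (2 ^ J * t - j)`. -/
def perHat (J j : ℕ) (t : ℝ) : ℝ := hat (2 ^ J * t - j) + hat (2 ^ J * t - j - 2 ^ J)

lemma perHat_nonneg (J j : ℕ) (t : ℝ) : 0 ≤ perHat J j t := add_nonneg (hat_nonneg _) (hat_nonneg _)

lemma continuous_perHat (J j : ℕ) : Continuous (perHat J j) := by
  unfold perHat
  exact (continuous_hat.comp (by fun_prop)).add (continuous_hat.comp (by fun_prop))

/-- The unshifted argument lies between 1 - 2^J and 2^J, so any other shift leaves the support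
[-1,1] of the hat. -/
lemma hat_shift_eq_zero {J : ℕ} (j : Fin (2 ^ J)) {t : ℝ} (ht : t ∈ Set.Ico (0 : ℝ) 1) {l : ℤ}
    (hl : l ∉ ({0, -1} : Finset ℤ)) : hat (2 ^ J * t - (j : ℝ) + 2 ^ J * (l : ℝ)) = 0 := by
  have hn : (1 : ℝ) ≤ 2 ^ J := one_le_pow₀ (by norm_num)
  have hj : (j : ℝ) + 1 ≤ 2 ^ J := by exact_mod_cast j.2
  have hj0 : (0 : ℝ) ≤ j := by positivity
  have h0 : 0 ≤ 2 ^ J * t := mul_nonneg (by linarith) ht.1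
  have h1 : 2 ^ J * t ≤ 2 ^ J := mul_le_of_le_one_right (by linarith) ht.2.le
  simp only [Finset.mem_insert, Finset.mem_singleton, not_or] at hl
  apply hat_eq_zero
  rcases (show 1 ≤ l ∨ l ≤ -2 by omega) with h | h
  · have h' : (1 : ℝ) ≤ l := by exact_mod_cast h
    refine le_trans ?_ (le_abs_self _)
    nlinarith
  · have h' : (l : ℝ) ≤ -2 := by exact_mod_cast h
    refine le_trans ?_ (neg_le_abs _)
    nlinarith

lemma periodicHat_eq {J : ℕ} (k : Grid J) {x : ℝ × ℝ} (hx : x ∈ unitSquare) :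
    periodicHat J k x = perHat J k.1 x.1 * perHat J k.2 x.2 := by
  unfold periodicHat tensorHat
  rw [tsum_eq_sum (s := ({0, -1} : Finset ℤ) ×ˢ ({0, -1} : Finset ℤ))]
  · rw [Finset.sum_product, ← Finset.sum_mul_sum (f := fun l : ℤ => hat (2 ^ J * x.1 - (k.1 : ℝ) +
      2 ^ J * (l : ℝ))) (g := fun l : ℤ => hat (2 ^ J * x.2 - (k.2 : ℝ) + 2 ^ J * (l : ℝ))),
      Finset.sum_pair (by norm_num), Finset.sum_pair (by norm_num)]
    simp [perHat, sub_eq_add_neg]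
  · intro l hl
    rw [Finset.mem_product, not_and_or] at hl
    rcases hl with hl | hl
    · simp only [hat_shift_eq_zero k.1 hx.1 hl, zero_mul]
    · simp only [hat_shift_eq_zero k.2 hx.2 hl, mul_zero]

/-- Among the wrapped copies only that of j = 0 is nonzero on [0,1); it plays the hat at the missing
node 2^J. At each point only the two adjacent nodes then count. -/
lemma sum_perHat {J : ℕ} {t : ℝ} (ht : t ∈ Set.Ico (0 : ℝ) 1) :
    ∑ j : Fin (2 ^ J), perHat J j t = 1 := by
  set n := 2 ^ J with hn
  have hnpos : 0 < n := by positivity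
  have hnr : (2 : ℝ) ^ J = n := by rw [hn]; push_cast; rfl
  have hn1 : (1 : ℝ) ≤ n := by exact_mod_cast hnpos
  set a : ℝ := n * t with ha
  have ha0 : 0 ≤ a := mul_nonneg (by linarith) ht.1
  have ha1 : a < n := by
    rw [ha]; exact mul_lt_of_lt_one_right (by linarith) ht.2
  have h1 : ∑ j : Fin n, perHat J j t = ∑ j ∈ Finset.range (n + 1), hat (a - j) := by
    rw [Finset.sum_range_succ, Finset.sum_range]
    simp only [perHat, hnr, Finset.sum_add_distrib]
    congr 1
    rw [Finset.sum_eq_single (⟨0, hnpos⟩ : Fin n)]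
    · simp [ha]
    · intro j _ hj
      have hj' : (1 : ℝ) ≤ (j : ℕ) := by
        have : (j : ℕ) ≠ 0 := fun h => hj (Fin.ext h)
        exact_mod_cast Nat.one_le_iff_ne_zero.2 this
      exact hat_eq_zero (le_trans (by linarith) (neg_le_abs _))
    · simp
  rw [h1]
  set i := ⌊a⌋₊ with hi
  have hi1 : (i : ℝ) ≤ a := Nat.floor_le ha0
  have hi2 : a < i + 1 := Nat.lt_floor_add_one a
  have hin : i < n := by
    have : (i : ℝ) < n := hi1.trans_lt ha1
    exact_mod_cast this
  rw [Finset.sum_eq_add (a := i) (b := i + 1) (by omega)]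
  · unfold hat
    rw [abs_of_nonneg (by linarith), abs_of_nonpos (by push_cast; linarith),
      max_eq_left (by linarith), max_eq_left (by push_cast; linarith)]
    push_cast; ring
  · intro j _ hj
    apply hat_eq_zero
    rcases (show j + 1 ≤ i ∨ i + 2 ≤ j by omega) with h | h
    · have : (j : ℝ) + 1 ≤ i := by exact_mod_cast h
      exact le_trans (by linarith) (le_abs_self _)
    · have : (i : ℝ) + 2 ≤ j := by exact_mod_cast h
      exact le_trans (by linarith) (neg_le_abs _)
  · intro h; exact absurd (Finset.mem_range.2 (by omega)) h
  · intro h; exact absurd (Finset.mem_range.2 (by omega)) h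

/-- Wrap-around is felt only in the last cell, so to the left of it a nonzero value means that node
j is near. -/
lemma abs_lt_of_perHat_ne_zero {J j : ℕ} {t : ℝ} (ht : 2 ^ J * t ≤ 2 ^ J - 1)
    (h : perHat J j t ≠ 0) : |2 ^ J * t - j| < 1 := by
  by_contra! hc
  apply h
  have hj0 : (0 : ℝ) ≤ j := by positivity
  rw [perHat, hat_eq_zero hc, zero_add]
  exact hat_eq_zero (le_trans (by linarith) (neg_le_abs _))

lemma lintegral_hat_le (J : ℕ) (c : ℝ) :
    ∫⁻ t, ENNReal.ofReal (hat (2 ^ J * t - c)) ≤ ENNReal.ofReal (2 / 2 ^ J) := by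
  have hn : (0 : ℝ) < 2 ^ J := by positivity
  set s : Set ℝ := Set.Icc ((c - 1) / 2 ^ J) ((c + 1) / 2 ^ J)
  calc ∫⁻ t, ENNReal.ofReal (hat (2 ^ J * t - c)) ≤ ∫⁻ t, s.indicator 1 t := by
        refine lintegral_mono fun t => ?_
        by_cases ht : t ∈ s
        · rw [Set.indicator_of_mem ht]
          simpa using hat_le_one _
        · have : hat (2 ^ J * t - c) = 0 := by
            apply hat_eq_zero
            by_contra! hc
            rw [abs_lt] at hc
            refine ht ⟨?_, ?_⟩
            · rw [div_le_iff₀' hn]; linarith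
            · rw [le_div_iff₀' hn]; linarith
          simp [this]
    _ = ENNReal.ofReal (2 / 2 ^ J) := by
        rw [lintegral_indicator_one measurableSet_Icc, Real.volume_Icc]
        congr 1; ring

lemma lintegral_perHat_le (J j : ℕ) :
    ∫⁻ t, ENNReal.ofReal (perHat J j t) ≤ ENNReal.ofReal (4 / 2 ^ J) := by
  unfold perHat
  simp only [ENNReal.ofReal_add (hat_nonneg _) (hat_nonneg _)]
  rw [lintegral_add_left (f := fun t => ENNReal.ofReal (hat (2 ^ J * t - j)))
    (continuous_hat.comp (by fun_prop)).measurable.ennreal_ofReal]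
  simp only [sub_sub]
  refine (add_le_add (lintegral_hat_le J _) (lintegral_hat_le J _)).trans (le_of_eq ?_)
  rw [← ENNReal.ofReal_add (by positivity) (by positivity)]
  congr 1; ring

/-- The product of the periodized hats, a continuous version of `periodicHat` on the square. -/
def prodHat (J : ℕ) (k : Grid J) (x : ℝ × ℝ) : ℝ := perHat J k.1 x.1 * perHat J k.2 x.2

lemma prodHat_nonneg {J : ℕ} (k : Grid J) (x : ℝ × ℝ) : 0 ≤ prodHat J k x :=
  mul_nonneg (perHat_nonneg _ _ _) (perHat_nonneg _ _ _)

lemma continuous_prodHat {J : ℕ} (k : Grid J) : Continuous (prodHat J k) :=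
  ((continuous_perHat J _).comp continuous_fst).mul ((continuous_perHat J _).comp continuous_snd)

lemma sum_prodHat {J : ℕ} {x : ℝ × ℝ} (hx : x ∈ unitSquare) : ∑ k, prodHat J k x = 1 := by
  unfold prodHat
  rw [Fintype.sum_prod_type]
  simp only
  rw [← Finset.sum_mul_sum (f := fun j : Fin (2 ^ J) => perHat J j x.1)
    (g := fun j : Fin (2 ^ J) => perHat J j x.2), sum_perHat hx.1, sum_perHat hx.2, one_mul]

lemma prodHat_le_one {J : ℕ} (k : Grid J) {x : ℝ × ℝ} (hx : x ∈ unitSquare) :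
    prodHat J k x ≤ 1 := by
  rw [← sum_prodHat (J := J) hx]
  exact Finset.single_le_sum (f := fun k => prodHat J k x) (fun k _ => prodHat_nonneg k x)
    (Finset.mem_univ k)

lemma lintegral_prodHat_le {J : ℕ} (k : Grid J) :
    ∫⁻ x, ENNReal.ofReal (prodHat J k x) ≤ ENNReal.ofReal (16 / 2 ^ (2 * J)) := by
  unfold prodHat
  simp only [ENNReal.ofReal_mul (perHat_nonneg _ _ _)]
  rw [Measure.volume_eq_prod, lintegral_prod_mul
    (continuous_perHat J _).measurable.ennreal_ofReal.aemeasurable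
    (continuous_perHat J _).measurable.ennreal_ofReal.aemeasurable]
  refine (mul_le_mul' (lintegral_perHat_le J _) (lintegral_perHat_le J _)).trans (le_of_eq ?_)
  rw [← ENNReal.ofReal_mul (by positivity)]
  congr 1
  rw [pow_mul']; field_simp; norm_num

/-! ### The interpolant -/

/-- A continuous version of `interpolant` on the square. -/
def hatInterp (J : ℕ) (u : Grid J → ℝ) (x : ℝ × ℝ) : ℝ := ∑ k, u k * prodHat J k x

lemma interpolant_eq {J : ℕ} (u : Grid J → ℝ) {x : ℝ × ℝ} (hx : x ∈ unitSquare) :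
    interpolant J u x = hatInterp J u x :=
  Finset.sum_congr rfl fun k _ => by rw [periodicHat_eq k hx, prodHat]

lemma continuous_hatInterp {J : ℕ} (u : Grid J → ℝ) : Continuous (hatInterp J u) :=
  continuous_finsetSum _ fun k _ => continuous_const.mul (continuous_prodHat k)

lemma hatInterp_sub {J : ℕ} (u v : Grid J → ℝ) (x : ℝ × ℝ) :
    hatInterp J (fun k => u k - v k) x = hatInterp J u x - hatInterp J v x := by
  simp only [hatInterp, sub_mul, Finset.sum_sub_distrib]

lemma hatInterp_sub_const {J : ℕ} (u : Grid J → ℝ) {x : ℝ × ℝ} (hx : x ∈ unitSquare) (c : ℝ) :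
    hatInterp J u x - c = ∑ k, (u k - c) * prodHat J k x := by
  simp only [hatInterp, sub_mul, Finset.sum_sub_distrib, ← Finset.mul_sum, sum_prodHat hx, mul_one]

lemma hatInterp_mem_Icc {J : ℕ} {u : Grid J → ℝ} {M : ℝ} (hu : ∀ k, u k ∈ Set.Icc 0 M)
    {x : ℝ × ℝ} (hx : x ∈ unitSquare) : hatInterp J u x ∈ Set.Icc 0 M := by
  refine ⟨Finset.sum_nonneg fun k _ => mul_nonneg (hu k).1 (prodHat_nonneg k x), ?_⟩
  rw [← sub_nonpos, hatInterp_sub_const u hx]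
  exact Finset.sum_nonpos fun k _ =>
    mul_nonpos_of_nonpos_of_nonneg (by linarith [(hu k).2]) (prodHat_nonneg k x)

/-- Cauchy–Schwarz with the hats as weights of sum 1. -/
lemma sq_hatInterp_le {J : ℕ} (u : Grid J → ℝ) {x : ℝ × ℝ} (hx : x ∈ unitSquare) :
    hatInterp J u x ^ 2 ≤ ∑ k, u k ^ 2 * prodHat J k x := by
  have := Finset.sum_sq_le_sum_mul_sum_of_sq_le_mul Finset.univ
    (r := fun k => u k * prodHat J k x) (f := fun k => prodHat J k x)
    (g := fun k => u k ^ 2 * prodHat J k x) (fun k _ => prodHat_nonneg k x)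
    (fun k _ => mul_nonneg (sq_nonneg _) (prodHat_nonneg k x))
    (fun k _ => le_of_eq (by ring))
  rwa [sum_prodHat hx, one_mul] at this

lemma setLIntegral_sq_hatInterp_le {J : ℕ} (u : Grid J → ℝ) :
    ∫⁻ x in unitSquare, ENNReal.ofReal (hatInterp J u x ^ 2) ≤
      ENNReal.ofReal (16 * (1 / 2 ^ (2 * J) * ∑ k, |u k| ^ 2)) := by
  calc ∫⁻ x in unitSquare, ENNReal.ofReal (hatInterp J u x ^ 2)
      ≤ ∫⁻ x in unitSquare, ∑ k, ENNReal.ofReal (u k ^ 2) * ENNReal.ofReal (prodHat J k x) := by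
        refine setLIntegral_mono' measurableSet_unitSquare fun x hx => ?_
        refine (ENNReal.ofReal_le_ofReal (sq_hatInterp_le u hx)).trans (le_of_eq ?_)
        rw [ENNReal.ofReal_sum_of_nonneg fun k _ => mul_nonneg (sq_nonneg _) (prodHat_nonneg k x)]
        exact Finset.sum_congr rfl fun k _ => ENNReal.ofReal_mul (sq_nonneg _)
    _ ≤ ∫⁻ x, ∑ k, ENNReal.ofReal (u k ^ 2) * ENNReal.ofReal (prodHat J k x) :=
        setLIntegral_le_lintegral _ _
    _ = ∑ k, ENNReal.ofReal (u k ^ 2) * ∫⁻ x, ENNReal.ofReal (prodHat J k x) := by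
        rw [lintegral_finsetSum _ fun k _ =>
          (continuous_prodHat k).measurable.ennreal_ofReal.const_mul _]
        exact Finset.sum_congr rfl fun k _ =>
          lintegral_const_mul _ (continuous_prodHat k).measurable.ennreal_ofReal
    _ ≤ ∑ k, ENNReal.ofReal (u k ^ 2) * ENNReal.ofReal (16 / 2 ^ (2 * J)) :=
        Finset.sum_le_sum fun k _ => by gcongr; exact lintegral_prodHat_le k
    _ = _ := by
        rw [← Finset.sum_mul, ← ENNReal.ofReal_sum_of_nonneg fun k _ => sq_nonneg _,
          ← ENNReal.ofReal_mul (Finset.sum_nonneg fun k _ => sq_nonneg _)]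
        simp only [sq_abs]
        congr 1; ring

/-! ### The interpolation error of the samples -/

/-- The box of side `4 / 2 ^ J` around the origin. -/
def smallBox (J : ℕ) : Set (ℝ × ℝ) :=
  Set.Icc (-(2 / 2 ^ J)) (2 / 2 ^ J) ×ˢ Set.Icc (-(2 / 2 ^ J)) (2 / 2 ^ J)

lemma measurableSet_smallBox (J : ℕ) : MeasurableSet (smallBox J) :=
  measurableSet_Icc.prod measurableSet_Icc

lemma volume_smallBox (J : ℕ) : volume (smallBox J) = ENNReal.ofReal (16 / 2 ^ (2 * J)) := by
  rw [smallBox, Measure.volume_eq_prod, Measure.prod_prod, Real.volume_Icc,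
    ← ENNReal.ofReal_mul (by rw [sub_neg_eq_add]; positivity)]
  congr 1
  rw [pow_mul']; field_simp; norm_num

lemma enorm_sample_sub_le {J : ℕ} {F : ℝ × ℝ → ℝ} (hF : Integrable F) (k : Grid J) (c : ℝ) :
    ‖sample J F k - c‖ₑ ≤
      ENNReal.ofReal (2 ^ (2 * J)) * ∫⁻ y in cell J k, ‖F y - c‖ₑ := by
  have hpos : (0 : ℝ) < 2 ^ (2 * J) := by positivity
  have hfin : volume (cell J k) ≠ ⊤ := by rw [volume_cell]; simp
  have h1 : sample J F k - c = 2 ^ (2 * J) * ∫ y in cell J k, (F y - c) := by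
    rw [integral_sub hF.integrableOn (integrableOn_const hfin), setIntegral_const,
      volume_real_cell, smul_eq_mul, mul_sub, sample]
    field_simp
  rw [h1, enorm_mul, Real.enorm_of_nonneg hpos.le]
  gcongr
  exact enorm_integral_le_lintegral_enorm _

/-- One mesh width for the support of the hat and one for the cell give the radius 2 / 2^J. -/
lemma cell_subset_smallBox {J : ℕ} {k : Grid J} {x : ℝ × ℝ} (h1 : |2 ^ J * x.1 - (k.1 : ℕ)| < 1)
    (h2 : |2 ^ J * x.2 - (k.2 : ℕ)| < 1) : cell J k ⊆ {y | y - x ∈ smallBox J} := by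
  intro y hy
  rw [mem_cell] at hy
  have hn : (0 : ℝ) < 2 ^ J := by positivity
  rw [abs_lt] at h1 h2
  refine ⟨⟨?_, ?_⟩, ?_, ?_⟩
  · rw [neg_le, Prod.fst_sub, neg_sub, le_div_iff₀' hn]; linarith
  · rw [Prod.fst_sub, le_div_iff₀' hn]; linarith
  · rw [neg_le, Prod.snd_sub, neg_sub, le_div_iff₀' hn]; linarith
  · rw [Prod.snd_sub, le_div_iff₀' hn]; linarith

/-- Off the last row and column the interpolant at x averages only samples from cells near x. The
weights are at most 1 and the cells disjoint, so the local integrals add up inside the box. -/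
lemma enorm_hatInterp_sample_sub_le {J : ℕ} {F : ℝ × ℝ → ℝ} (hF : Integrable F)
    {x : ℝ × ℝ} (hx : x ∈ unitSquare) (h1 : 2 ^ J * x.1 ≤ 2 ^ J - 1)
    (h2 : 2 ^ J * x.2 ≤ 2 ^ J - 1) :
    ‖hatInterp J (sample J F) x - F x‖ₑ ≤ ENNReal.ofReal (2 ^ (2 * J)) *
      ∫⁻ y in unitSquare ∩ {y | y - x ∈ smallBox J}, ‖F y - F x‖ₑ := by
  set W : Set (ℝ × ℝ) := {y | y - x ∈ smallBox J} with hW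
  have hWm : MeasurableSet W := (measurableSet_smallBox J).preimage (measurable_sub_const x)
  have hterm : ∀ k, ‖(sample J F k - F x) * prodHat J k x‖ₑ ≤
      ENNReal.ofReal (2 ^ (2 * J)) * ∫⁻ y in cell J k ∩ W, ‖F y - F x‖ₑ := by
    intro k
    by_cases h0 : prodHat J k x = 0
    · simp [h0]
    have hsub : cell J k ⊆ W := cell_subset_smallBox
      (abs_lt_of_perHat_ne_zero h1 (left_ne_zero_of_mul h0))
      (abs_lt_of_perHat_ne_zero h2 (right_ne_zero_of_mul h0))
    rw [Set.inter_eq_left.2 hsub, enorm_mul]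
    refine le_trans (mul_le_of_le_one_right' ?_) (enorm_sample_sub_le hF k (F x))
    rw [Real.enorm_of_nonneg (prodHat_nonneg k x)]
    simpa using prodHat_le_one k hx
  rw [hatInterp_sub_const _ hx]
  calc ‖∑ k, (sample J F k - F x) * prodHat J k x‖ₑ
      ≤ ∑ k, ‖(sample J F k - F x) * prodHat J k x‖ₑ := enorm_sum_le _ _
    _ ≤ ∑ k, ENNReal.ofReal (2 ^ (2 * J)) * ∫⁻ y in cell J k ∩ W, ‖F y - F x‖ₑ :=
        Finset.sum_le_sum fun k _ => hterm k
    _ = ENNReal.ofReal (2 ^ (2 * J)) *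
          ∫⁻ y in ⋃ k ∈ (Finset.univ : Finset (Grid J)), cell J k ∩ W, ‖F y - F x‖ₑ := by
        rw [← Finset.mul_sum, lintegral_biUnion_finset
          (fun k _ l _ hkl => Set.disjoint_left.2 fun y hy hy' => hkl (eq_of_mem_cell hy.1 hy'.1))
          (fun k _ => (measurableSet_cell J k).inter hWm)]
    _ ≤ _ := by
        gcongr
        exact Set.iUnion₂_subset fun k _ => Set.inter_subset_inter_left _ (cell_subset J k)

/-- Substitute y = x + z and exchange the integrals: for each z in the box the inner integral is the
translation modulus at z. -/
lemma lintegral_lintegral_smallBox_le {F : ℝ × ℝ → ℝ} (hF : Integrable F) (hm : Measurable F)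
    (hs : ∀ x, x ∉ unitSquare → F x = 0) {μ ν : SignedMeasure (ℝ × ℝ)}
    (hμ : HasMeasureDerivative F (1, 0) μ) (hν : HasMeasureDerivative F (0, 1) ν) (J : ℕ) :
    ∫⁻ x in unitSquare, ∫⁻ y in unitSquare ∩ {y | y - x ∈ smallBox J}, ‖F y - F x‖ₑ ≤
      ENNReal.ofReal (16 / 2 ^ (2 * J)) *
        ENNReal.ofReal (2 / 2 ^ J * (totalMass μ + totalMass ν)) := by
  have hsq := measurableSet_unitSquare
  set G : (ℝ × ℝ) → (ℝ × ℝ) → ENNReal := fun x z =>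
    ({p : (ℝ × ℝ) × (ℝ × ℝ) | p.1 + p.2 ∈ unitSquare}.indicator
      (fun p => ‖F (p.1 + p.2) - F p.1‖ₑ)) (x, z) with hG
  have hGm : Measurable (Function.uncurry G) := by
    have : Function.uncurry G = {p : (ℝ × ℝ) × (ℝ × ℝ) | p.1 + p.2 ∈ unitSquare}.indicator
      (fun p => ‖F (p.1 + p.2) - F p.1‖ₑ) := by ext ⟨x, z⟩; rfl
    rw [this]
    exact (((hm.comp (measurable_fst.add measurable_snd)).sub (hm.comp measurable_fst)).enorm).indicator
      (hsq.preimage (measurable_fst.add measurable_snd))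
  calc ∫⁻ x in unitSquare, ∫⁻ y in unitSquare ∩ {y | y - x ∈ smallBox J}, ‖F y - F x‖ₑ
      = ∫⁻ x in unitSquare, ∫⁻ z in smallBox J, G x z := by
        refine lintegral_congr fun x => ?_
        rw [← lintegral_indicator (measurableSet_smallBox J), ← lintegral_indicator
          (s := unitSquare ∩ {y | y - x ∈ smallBox J})
          (hsq.inter ((measurableSet_smallBox J).preimage (measurable_sub_const x))),
          ← lintegral_add_left_eq_self _ x]
        refine lintegral_congr fun z => ?_
        by_cases h1 : z ∈ smallBox J <;> by_cases h2 : x + z ∈ unitSquare <;>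
          simp [Set.indicator, hG, h1, h2]
    _ = ∫⁻ z in smallBox J, ∫⁻ x in unitSquare, G x z :=
        lintegral_lintegral_swap hGm.aemeasurable
    _ ≤ ∫⁻ z in smallBox J, ENNReal.ofReal (2 / 2 ^ J * (totalMass μ + totalMass ν)) := by
        refine setLIntegral_mono' (measurableSet_smallBox J) fun z hz => ?_
        have h1 : ∫⁻ x in unitSquare, G x z =
            ∫⁻ x in {x | x ∈ unitSquare ∧ x + z ∈ unitSquare}, ‖F (x + z) - F x‖ₑ := by
          rw [← lintegral_indicator hsq, ← lintegral_indicator (measurableSet_overlap z)]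
          refine lintegral_congr fun x => ?_
          by_cases h1 : x ∈ unitSquare <;> by_cases h2 : x + z ∈ unitSquare <;>
            simp [Set.indicator, hG, h1, h2]
        rw [h1]
        refine (setLIntegral_overlap_le hF hm hs hμ hν z).trans (ENNReal.ofReal_le_ofReal ?_)
        have a1 : |z.1| ≤ 2 / 2 ^ J := abs_le.2 hz.1
        have a2 : |z.2| ≤ 2 / 2 ^ J := abs_le.2 hz.2
        have b1 := mul_le_mul_of_nonneg_left a1 (totalMass_nonneg μ)
        have b2 := mul_le_mul_of_nonneg_left a2 (totalMass_nonneg ν)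
        linarith
    _ = _ := by rw [setLIntegral_const, volume_smallBox, mul_comm]

lemma setLIntegral_hatInterp_sample_sub_le {F : ℝ × ℝ → ℝ} (hF : Integrable F) (hm : Measurable F)
    (hs : ∀ x, x ∉ unitSquare → F x = 0) {M : ℝ} (hM : ∀ x, F x ∈ Set.Icc 0 M)
    {μ ν : SignedMeasure (ℝ × ℝ)}
    (hμ : HasMeasureDerivative F (1, 0) μ) (hν : HasMeasureDerivative F (0, 1) ν) (J : ℕ) :
    ∫⁻ x in unitSquare, ‖hatInterp J (sample J F) x - F x‖ₑ ≤
      ENNReal.ofReal ((32 * (totalMass μ + totalMass ν) + 2 * M) / 2 ^ J) := by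
  have hM0 : 0 ≤ M := (hM 0).1.trans (hM 0).2
  have hn : (0 : ℝ) < 2 ^ J := by positivity
  have hV : 0 ≤ totalMass μ + totalMass ν := add_nonneg (totalMass_nonneg _) (totalMass_nonneg _)
  set Ic : Set ℝ := Set.Ico (1 - 1 / 2 ^ J) 1
  -- In these strips periodization mixes opposite sides of the square, where f need not match; the
  -- trivial bound M is used there, at the cost of their area, at most 2 / 2^J.
  set E : Set (ℝ × ℝ) := Ic ×ˢ Set.Ico 0 1 ∪ Set.Ico 0 1 ×ˢ Ic with hE
  have hEm : MeasurableSet E := (measurableSet_Ico.prod measurableSet_Ico).union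
    (measurableSet_Ico.prod measurableSet_Ico)
  have hEv : volume E ≤ ENNReal.ofReal (2 / 2 ^ J) := by
    refine (measure_union_le _ _).trans (le_of_eq ?_)
    rw [Measure.volume_eq_prod, Measure.prod_prod, Measure.prod_prod, Real.volume_Ico,
      Real.volume_Ico, sub_zero, ENNReal.ofReal_one, mul_one, one_mul, ← ENNReal.ofReal_add
      (by simp) (by simp)]
    congr 1; ring
  calc ∫⁻ x in unitSquare, ‖hatInterp J (sample J F) x - F x‖ₑ
      ≤ ∫⁻ x in unitSquare, (E.indicator (fun _ => ENNReal.ofReal M) x +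
          ENNReal.ofReal (2 ^ (2 * J)) *
            ∫⁻ y in unitSquare ∩ {y | y - x ∈ smallBox J}, ‖F y - F x‖ₑ) := by
        refine setLIntegral_mono' measurableSet_unitSquare fun x hx => ?_
        by_cases hxE : x ∈ E
        · rw [Set.indicator_of_mem hxE]
          refine le_add_right ?_
          rw [Real.enorm_eq_ofReal_abs]
          refine ENNReal.ofReal_le_ofReal (abs_le.2 ?_)
          have h1 := hatInterp_mem_Icc (sample_mem_Icc hF hM J) hx
          exact ⟨by linarith [h1.1, (hM x).2], by linarith [h1.2, (hM x).1]⟩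
        · refine le_add_left (enorm_hatInterp_sample_sub_le hF hx ?_ ?_)
          · by_contra! hc
            refine hxE (Or.inl ⟨⟨?_, hx.1.2⟩, hx.2⟩)
            rw [sub_le_iff_le_add, ← sub_le_iff_le_add', le_div_iff₀ hn]
            linarith
          · by_contra! hc
            refine hxE (Or.inr ⟨hx.1, ?_, hx.2.2⟩)
            rw [sub_le_iff_le_add, ← sub_le_iff_le_add', le_div_iff₀ hn]
            linarith
    _ = (∫⁻ x in unitSquare, E.indicator (fun _ => ENNReal.ofReal M) x) +
          ENNReal.ofReal (2 ^ (2 * J)) * ∫⁻ x in unitSquare,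
            ∫⁻ y in unitSquare ∩ {y | y - x ∈ smallBox J}, ‖F y - F x‖ₑ := by
        rw [lintegral_add_left (measurable_const.indicator hEm),
          lintegral_const_mul' _ _ ENNReal.ofReal_ne_top]
    _ ≤ ENNReal.ofReal M * ENNReal.ofReal (2 / 2 ^ J) + ENNReal.ofReal (2 ^ (2 * J)) *
          (ENNReal.ofReal (16 / 2 ^ (2 * J)) *
            ENNReal.ofReal (2 / 2 ^ J * (totalMass μ + totalMass ν))) := by
        refine add_le_add ((setLIntegral_le_lintegral _ _).trans ?_) ?_
        · rw [lintegral_indicator_const hEm]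
          gcongr
        · gcongr
          exact lintegral_lintegral_smallBox_le hF hm hs hμ hν J
    _ = _ := by
        rw [← ENNReal.ofReal_mul hM0, ← ENNReal.ofReal_mul (by positivity),
          ← ENNReal.ofReal_mul (by positivity), ← ENNReal.ofReal_add (by positivity) (by positivity)]
        congr 1
        field_simp
        ring

/-- Split off the interpolated samples by (p + q)² ≤ 2p² + 2q². Since |q| ≤ M, q² ≤ M|q| and the L¹
estimate is enough. -/
lemma setLIntegral_sq_hatInterp_sub_le {F : ℝ × ℝ → ℝ} (hF : Integrable F) (hm : Measurable F)
    (hs : ∀ x, x ∉ unitSquare → F x = 0) {M : ℝ} (hM : ∀ x, F x ∈ Set.Icc 0 M)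
    {μ ν : SignedMeasure (ℝ × ℝ)}
    (hμ : HasMeasureDerivative F (1, 0) μ) (hν : HasMeasureDerivative F (0, 1) ν) {J : ℕ}
    (u : Grid J → ℝ) :
    ∫⁻ x in unitSquare, ENNReal.ofReal ((hatInterp J u x - F x) ^ 2) ≤
      ENNReal.ofReal (32 * (1 / 2 ^ (2 * J) * ∑ k, |u k - sample J F k| ^ 2) +
        2 * M * (32 * (totalMass μ + totalMass ν) + 2 * M) / 2 ^ J) := by
  have hM0 : 0 ≤ M := (hM 0).1.trans (hM 0).2
  have hV : 0 ≤ totalMass μ + totalMass ν := add_nonneg (totalMass_nonneg _) (totalMass_nonneg _)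
  set w : Grid J → ℝ := fun k => u k - sample J F k with hw
  calc ∫⁻ x in unitSquare, ENNReal.ofReal ((hatInterp J u x - F x) ^ 2)
      ≤ ∫⁻ x in unitSquare, (ENNReal.ofReal 2 * ENNReal.ofReal (hatInterp J w x ^ 2) +
          ENNReal.ofReal (2 * M) * ‖hatInterp J (sample J F) x - F x‖ₑ) := by
        refine setLIntegral_mono' measurableSet_unitSquare fun x hx => ?_
        have h1 := hatInterp_mem_Icc (sample_mem_Icc hF hM J) hx
        have h2 : |hatInterp J (sample J F) x - F x| ≤ M :=
          abs_le.2 ⟨by linarith [h1.1, (hM x).2], by linarith [h1.2, (hM x).1]⟩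
        rw [Real.enorm_eq_ofReal_abs, ← ENNReal.ofReal_mul (by norm_num),
          ← ENNReal.ofReal_mul (by positivity), ← ENNReal.ofReal_add (by positivity) (by positivity)]
        refine ENNReal.ofReal_le_ofReal ?_
        have h3 : hatInterp J u x - F x =
            hatInterp J w x + (hatInterp J (sample J F) x - F x) := by
          rw [hw, hatInterp_sub]; ring
        rw [h3]
        have h4 := mul_le_mul_of_nonneg_right h2 (abs_nonneg (hatInterp J (sample J F) x - F x))
        rw [abs_mul_abs_self] at h4
        nlinarith [sq_nonneg (hatInterp J w x - (hatInterp J (sample J F) x - F x))]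
    _ = ENNReal.ofReal 2 * (∫⁻ x in unitSquare, ENNReal.ofReal (hatInterp J w x ^ 2)) +
          ENNReal.ofReal (2 * M) *
            ∫⁻ x in unitSquare, ‖hatInterp J (sample J F) x - F x‖ₑ := by
        rw [lintegral_add_left
          (f := fun x => ENNReal.ofReal 2 * ENNReal.ofReal (hatInterp J w x ^ 2))
          (((continuous_hatInterp w).pow 2).measurable.ennreal_ofReal.const_mul _),
          lintegral_const_mul' _ _ ENNReal.ofReal_ne_top,
          lintegral_const_mul' _ _ ENNReal.ofReal_ne_top]
    _ ≤ ENNReal.ofReal 2 * ENNReal.ofReal (16 * (1 / 2 ^ (2 * J) * ∑ k, |w k| ^ 2)) +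
          ENNReal.ofReal (2 * M) *
            ENNReal.ofReal ((32 * (totalMass μ + totalMass ν) + 2 * M) / 2 ^ J) := by
        gcongr
        · exact setLIntegral_sq_hatInterp_le w
        · exact setLIntegral_hatInterp_sample_sub_le hF hm hs hM hμ hν J
    _ = _ := by
        have h0 : 0 ≤ ∑ k, |w k| ^ 2 := Finset.sum_nonneg fun k _ => by positivity
        rw [← ENNReal.ofReal_mul (by norm_num), ← ENNReal.ofReal_mul (by positivity),
          ← ENNReal.ofReal_add (by positivity) (by positivity)]
        congr 1; ring

/-! ### Bounded measurable representatives -/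

lemma exists_representative {f : ℝ × ℝ → ℝ} {M : ℝ} (hM : 0 ≤ M)
    (hf : Integrable f squareMeasure) (hr : ∀ᵐ x ∂squareMeasure, f x ∈ Set.Icc 0 M) :
    ∃ F : ℝ × ℝ → ℝ, Measurable F ∧ Integrable F ∧ (∀ x, x ∉ unitSquare → F x = 0) ∧
      (∀ x, F x ∈ Set.Icc 0 M) ∧ f =ᵐ[squareMeasure] F := by
  obtain ⟨f', hf'm, hf'⟩ := hf.aestronglyMeasurable
  set F : ℝ × ℝ → ℝ := unitSquare.indicator fun x => max 0 (min M (f' x)) with hF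
  have hmem : ∀ᵐ x ∂squareMeasure, x ∈ unitSquare := ae_restrict_mem measurableSet_unitSquare
  have hae : f =ᵐ[squareMeasure] F := by
    filter_upwards [hf', hr, hmem] with x h1 h2 h3
    rw [hF, Set.indicator_of_mem h3, ← h1, min_eq_right h2.2, max_eq_right h2.1]
  have hs : ∀ x, x ∉ unitSquare → F x = 0 := fun x hx => Set.indicator_of_notMem hx _
  refine ⟨F, ?_, ?_, hs, fun x => ?_, hae⟩
  · exact (measurable_const.max (measurable_const.min hf'm.measurable)).indicator
      measurableSet_unitSquare
  · have : IntegrableOn F unitSquare := hf.congr hae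
    exact this.integrable_of_forall_notMem_eq_zero hs
  · by_cases hx : x ∈ unitSquare
    · rw [hF, Set.indicator_of_mem hx]
      exact ⟨le_max_left _ _, max_le hM (min_le_left _ _)⟩
    · rw [hs x hx]; exact ⟨le_rfl, hM⟩

lemma HasMeasureDerivative.congr {f F : ℝ × ℝ → ℝ} {e : ℝ × ℝ} {μ : SignedMeasure (ℝ × ℝ)}
    (h : HasMeasureDerivative f e μ) (hae : f =ᵐ[squareMeasure] F) : HasMeasureDerivative F e μ := by
  intro ψ hψ
  rw [← h ψ hψ]
  exact integral_congr_ae (hae.mono fun x hx => by simp only [hx])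

lemma sample_congr {f F : ℝ × ℝ → ℝ} (hae : f =ᵐ[squareMeasure] F) (J : ℕ) :
    sample J f = sample J F := by
  funext k
  unfold sample
  congr 1
  exact integral_congr_ae (ae_restrict_of_ae_restrict_of_subset (cell_subset J k) hae)

lemma eLpNorm_sq_interpolant_sub {f F : ℝ × ℝ → ℝ} (hae : f =ᵐ[squareMeasure] F) {J : ℕ}
    (u : Grid J → ℝ) :
    eLpNorm (fun x => interpolant J u x - f x) 2 squareMeasure ^ 2 =
      ∫⁻ x in unitSquare, ENNReal.ofReal ((hatInterp J u x - F x) ^ 2) := by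
  have h1 := eLpNorm_nnreal_pow_eq_lintegral (μ := squareMeasure)
    (f := fun x => interpolant J u x - f x) (p := 2) two_ne_zero
  have h2 : eLpNorm (fun x => interpolant J u x - f x) 2 squareMeasure ^ 2 =
      ∫⁻ x, ‖interpolant J u x - f x‖ₑ ^ ((2 : NNReal) : ℝ) ∂squareMeasure := by
    rw [← h1]; norm_num
  rw [h2]
  have hmem : ∀ᵐ x ∂squareMeasure, x ∈ unitSquare := ae_restrict_mem measurableSet_unitSquare
  refine lintegral_congr_ae ?_
  filter_upwards [hae, hmem] with x hx hxs
  rw [interpolant_eq u hxs, hx, Real.enorm_eq_ofReal_abs, NNReal.coe_ofNat, ENNReal.rpow_ofNat,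
    ← ENNReal.ofReal_pow (abs_nonneg _), sq_abs]

lemma subsetProb_mono {ι : Type*} [Fintype ι] {m : ℕ} {E E' : Finset ι → Prop}
    (h : ∀ S, E S → E' S) : subsetProb m E ≤ subsetProb m E' := by
  classical
  unfold subsetProb
  refine div_le_div_of_nonneg_right ?_ (Nat.cast_nonneg _)
  exact Nat.cast_le.2 (Finset.card_le_card fun S hS =>
    Finset.mem_filter.2 ⟨(Finset.mem_filter.1 hS).1, h S (Finset.mem_filter.1 hS).2⟩)

lemma subsetProb_nonneg {ι : Type*} [Fintype ι] (m : ℕ) (E : Finset ι → Prop) :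
    0 ≤ subsetProb m E := by
  unfold subsetProb; positivity

lemma rate_sq_mul {J m : ℕ} (hm : 1 ≤ m) :
    (((m : ℝ) / 2 ^ (2 * J)) ^ (-(1 / 2) : ℝ) * (J : ℝ) ^ (3 / 2 : ℝ) *
      (2 : ℝ) ^ (-((J : ℝ) / 2))) ^ 2 * m = 2 ^ J * (J : ℝ) ^ 3 := by
  have hmr : (0 : ℝ) < m := by exact_mod_cast hm
  rw [mul_pow, mul_pow, ← Real.rpow_mul_natCast (by positivity),
    ← Real.rpow_mul_natCast (by positivity), ← Real.rpow_mul_natCast (by positivity)]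
  have e1 : (-(1 / 2) : ℝ) * (2 : ℕ) = -1 := by norm_num
  have e2 : (3 / 2 : ℝ) * (2 : ℕ) = (3 : ℕ) := by norm_num
  have e3 : -((J : ℝ) / 2) * (2 : ℕ) = -(J : ℝ) := by push_cast; ring
  rw [e1, e2, e3, Real.rpow_neg_one, Real.rpow_natCast, Real.rpow_neg (by norm_num),
    Real.rpow_natCast, pow_mul']
  field_simp

end TVInpainting

end

/-! ### Assembly and choice of the constants -/

theorem theorem4 (M : ℝ) (f : ℝ × ℝ → ℝ) (hBV : TVInpainting.IsBV f)
    (hrange : ∀ᵐ x ∂TVInpainting.squareMeasure, f x ∈ Set.Icc 0 M)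
    (hnonconst : ¬ ∃ a : ℝ, ∀ᵐ x ∂TVInpainting.squareMeasure, f x = a) :
    ∃ c C₁ C₂ C₃ : ℝ, 0 < c ∧ 0 < C₁ ∧ 0 < C₂ ∧ 0 < C₃ ∧
      ∀ (J m : ℕ) (η ρ : ℝ) (ε g : TVInpainting.Grid J → ℝ),
        1 ≤ m → m ≤ 2 ^ (2 * J) → 0 ≤ η → ρ = (m : ℝ) / 2 ^ (2 * J) →
        (∀ k, g k = TVInpainting.sample J f k + ε k) →
        1 - (2 : ℝ) ^ (-(2 * (J : ℝ))) ≤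
          TVInpainting.subsetProb m (fun S : Finset (TVInpainting.Grid J) =>
            TVInpainting.IsAdmissible S M η g ε →
            ∀ u : TVInpainting.Grid J → ℝ, TVInpainting.IsTVSolution S g η u →
              (1 / (2 : ℝ) ^ (2 * J)) * ∑ k, |u k - TVInpainting.sample J f k| ^ 2 ≤
                  c * ρ ^ (-(1 / 2) : ℝ) * (J : ℝ) ^ (3 / 2 : ℝ) * (2 : ℝ) ^ (-((J : ℝ) / 2)) +
                    16 / 3 * η ^ 2 ∧
              eLpNorm (fun x => TVInpainting.interpolant J u x - f x) 2
                  TVInpainting.squareMeasure ^ 2 ≤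
                ENNReal.ofReal
                  (C₁ * ρ ^ (-(1 / 2) : ℝ) * (J : ℝ) ^ (3 / 2 : ℝ) * (2 : ℝ) ^ (-((J : ℝ) / 2)) +
                    C₂ * η ^ 2 + C₃ * (2 : ℝ) ^ (-(J : ℝ)))) := by
  open MeasureTheory TVInpainting in
  have hM : 0 ≤ M := by
    rcases (ae squareMeasure).eq_or_neBot with h | h
    · exact absurd ⟨0, by rw [h]; exact Filter.eventually_bot⟩ hnonconst
    · obtain ⟨x, hx⟩ := hrange.exists
      exact hx.1.trans hx.2
  obtain ⟨F, hm, hF, hs, hFM, hae⟩ := TVInpainting.exists_representative hM hBV.integrable hrange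
  obtain ⟨μ, hμ⟩ := hBV.deriv_fst
  obtain ⟨ν, hν⟩ := hBV.deriv_snd
  replace hμ := hμ.congr hae
  replace hν := hν.congr hae
  set V : ℝ := TVInpainting.totalMass μ + TVInpainting.totalMass ν with hV
  have hV0 : 0 ≤ V :=
    add_nonneg (TVInpainting.totalMass_nonneg _) (TVInpainting.totalMass_nonneg _)
  have hc0 : 0 ≤ TVInpainting.errorConst M V := by unfold TVInpainting.errorConst; positivity
  -- 32 is the factor of the discrete error in `setLIntegral_sq_hatInterp_sub_le`; the summands 1
  -- serve strict positivity.
  refine ⟨TVInpainting.errorConst M V + 1, 32 * (TVInpainting.errorConst M V + 1), 32 * (16 / 3),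
    2 * M * (32 * V + 2 * M) + 1, by positivity, by positivity, by positivity, by positivity, ?_⟩
  intro J m η ρ ε g hm1 hmN hη hρ hg
  have hpow : (2 : ℝ) ^ (-(2 * (J : ℝ))) = ((2 : ℝ) ^ (2 * J))⁻¹ := by
    rw [Real.rpow_neg (by norm_num), ← Real.rpow_natCast]; push_cast; rfl
  have hpow' : (2 : ℝ) ^ (-(J : ℝ)) = ((2 : ℝ) ^ J)⁻¹ := by
    rw [Real.rpow_neg (by norm_num), Real.rpow_natCast]
  rw [hpow, hpow']
  -- For J = 0 the claimed probability is 1 - 1 = 0.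
  rcases Nat.eq_zero_or_pos J with hJ0 | hJ
  · refine le_trans ?_ (TVInpainting.subsetProb_nonneg _ _)
    simp [hJ0]
  set R : ℝ := ρ ^ (-(1 / 2) : ℝ) * (J : ℝ) ^ (3 / 2 : ℝ) * (2 : ℝ) ^ (-((J : ℝ) / 2)) with hR
  have hmul : ∀ b : ℝ, b * ρ ^ (-(1 / 2) : ℝ) * (J : ℝ) ^ (3 / 2 : ℝ) *
      (2 : ℝ) ^ (-((J : ℝ) / 2)) = b * R := fun b => by rw [hR]; ring
  simp only [hmul]
  have hmr : (0 : ℝ) < m := by exact_mod_cast hm1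
  have hJr : (0 : ℝ) < J := by exact_mod_cast hJ
  have hρ0 : 0 < ρ := by rw [hρ]; positivity
  have hR0 : 0 < R := by positivity
  have hRm : R ^ 2 * m = 2 ^ J * (J : ℝ) ^ 3 := by
    rw [hR, hρ]; exact TVInpainting.rate_sq_mul hm1
  rw [TVInpainting.sample_congr hae J] at hg ⊢
  have hbound := TVInpainting.discrete_bound (η := η) hJ hm1 hmN hM hV0 hR0 hRm
    (TVInpainting.sample_mem_Icc hF hFM J) (TVInpainting.gridTV_sample_le hF hm hs hμ hν J) hg
  refine hbound.trans (TVInpainting.subsetProb_mono fun S hS hadm u hu => ?_)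
  have h1 := hS hadm u hu
  refine ⟨h1.trans (by linarith), ?_⟩
  rw [TVInpainting.eLpNorm_sq_interpolant_sub hae]
  refine (TVInpainting.setLIntegral_sq_hatInterp_sub_le hF hm hs hFM hμ hν u).trans
    (ENNReal.ofReal_le_ofReal ?_)
  have h2 : 0 ≤ ((2 : ℝ) ^ J)⁻¹ := by positivity
  rw [← hV, div_eq_mul_inv (2 * M * (32 * V + 2 * M))]
  linarith
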